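/- Let $S_R^2\subset\mathbb{R}^3$ be the sphere of radius $R>0$ centred at the origin. A spherical polygon $P=(v_1,\dots,v_n)$ is a closed broken line on $S_R^2$ with cyclically numbered vertices $v_i$ whose edges $v_iv_{i+1}$ are shortest geodesics of lengths $0<l_i<\pi R$. For $\varepsilon>0$, its local configuration space $\mathbf{L}^{loc}_\varepsilon(P)$ is the set of all spherical polygons $Q=(w_1,\dots,w_n)$ with the same edge lengths and $|w_i-v_i|<\varepsilon$ for all $i$, where two such polygons are identified if they differ by a rotation of the sphere. Fix a point $\infty\in S_R^2$. For a polygon $Q$ not passing through $\infty$ let $$\mathcal{A}(Q)=\int_{S_R^2} w(Q,x)\,dx$$ be its oriented area, where $w(Q,x)$ is the winding number of $Q$ around $x$ in the oriented punctured sphere $S_R^2\setminus\{\infty\}$, identified with an oriented plane by stereographic projection. Proposition. Let $P$ be a spherical polygon that lies in a closed hemisphere not containing $\infty$. Assume that $P$ does not lie on a great circle (so that $\mathbf{L}^{loc}_\varepsilon(P)$ is smooth at $P$). Then for all sufficiently small $\varepsilon>0$ the oriented area is a well-defined function on $\mathbf{L}^{loc}_\varepsilon(P)$, and $P$ is a critical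 point of it (that is, along every curve $Q(t)$ in $\mathbf{L}^{loc}_\varepsilon(P)$ with $Q(0)=P$ that is represented by polygons whose vertices are differentiable at $t=0$, the function $\mathcal{A}(Q(t))$ has derivative $0$ at $t=0$) if and only if $P$ is cyclic, that is, all its vertices lie on a circle. -/

import Mathlib

open scoped Topology

noncomputable section

/-- Euclidean three-space, containing the sphere of radius `R` centred at the origin. -/
abbrev Space3 : Type := EuclideanSpace ℝ (Fin 3)

/-- The spherical (great-circle) distance of two points of the sphere of radius `R`. -/
def geodesicDist (R : ℝ) (a b : Space3) : ℝ :=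
  R * InnerProductGeometry.angle a b

/-- The shortest geodesic from `a` to `b` (two non-antipodal points of the sphere of radius `R`),
parametrised by `t ∈ [0, 1]`: the central projection of the chord to the sphere. -/
def geodesicArc (R : ℝ) (a b : Space3) (t : ℝ) : Space3 :=
  (R / ‖(1 - t) • a + t • b‖) • ((1 - t) • a + t • b)

/-- A spherical polygon with `n` cyclically numbered vertices on the sphere of radius `R`;
all edge lengths are positive and less than `π R`, so that the edges are the unique
shortest geodesics between consecutive vertices. -/
structure SphericalPolygon (n : ℕ) [NeZero n] (R : ℝ) where
  vertex : Fin n → Space3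
  norm_vertex : ∀ i, ‖vertex i‖ = R
  edge_pos : ∀ i, 0 < geodesicDist R (vertex i) (vertex (i + 1))
  edge_lt : ∀ i, geodesicDist R (vertex i) (vertex (i + 1)) < Real.pi * R

/-- The determinant of three vectors of `ℝ³` (standard orientation). -/
def det3 (a b c : Space3) : ℝ :=
  Matrix.det !![a 0, a 1, a 2; b 0, b 1, b 2; c 0, c 1, c 2]

/-- Stereographic projection of the sphere of radius `R` from its point `p` to the plane through
the origin orthogonal to `p`: the intersection of this plane with the line through `p` and `x`. -/
def stereo (R : ℝ) (p x : Space3) : Space3 :=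
  p + (R ^ 2 / (R ^ 2 - inner ℝ p x)) • (x - p)

/-- The closed hemisphere with centre `c`. -/
def closedHemisphere (R : ℝ) (c : Space3) : Set Space3 :=
  {x | ‖x‖ = R ∧ 0 ≤ inner ℝ c x}

/-- Rotations of `ℝ³` about the origin. -/
def IsRotation (ρ : Space3 ≃ₗᵢ[ℝ] Space3) : Prop :=
  LinearMap.det (ρ.toLinearEquiv : Space3 →ₗ[ℝ] Space3) = 1

namespace SphericalPolygon

variable {n : ℕ} [NeZero n] {R : ℝ}

/-- The length of the `i`-th edge. -/
def edgeLength (P : SphericalPolygon n R) (i : Fin n) : ℝ :=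
  geodesicDist R (P.vertex i) (P.vertex (i + 1))

/-- The `i`-th edge as a parametrised curve on `[0, 1]`. -/
def edge (P : SphericalPolygon n R) (i : Fin n) : ℝ → Space3 :=
  geodesicArc R (P.vertex i) (P.vertex (i + 1))

/-- The closed broken line, as a set of points of the sphere. -/
def trace (P : SphericalPolygon n R) : Set Space3 :=
  ⋃ i, P.edge i '' Set.Icc (0 : ℝ) 1

/-- The winding number of `P` around the point `x` in the sphere punctured at `p`. The punctured
sphere is identified with the plane orthogonal to `p` by stereographic projection; the plane is
oriented by the unit normal `-p / R`, which corresponds to the outward orientation of the sphere.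
In the plane, the winding number is `1 / 2π` times the integral over the closed curve of the angle
form (`(u dv - v du) / (u² + v²)` in oriented Cartesian coordinates `u`, `v` centred at the
image of `x`). It is the usual winding number for `p` and `x` off the polygon, `x ≠ p`. -/
def windingNumber (p : Space3) (P : SphericalPolygon n R) (x : Space3) : ℝ :=
  (1 / (2 * Real.pi)) * ∑ i, ∫ t in (0 : ℝ)..1,
    det3 (-(R⁻¹ • p)) (stereo R p (P.edge i t) - stereo R p x)
        (deriv (fun s => stereo R p (P.edge i s)) t) /
      ‖stereo R p (P.edge i t) - stereo R p x‖ ^ 2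

/-- The oriented area: the integral of the winding number over the sphere of radius `R`,
with respect to the surface measure (`R²` times the surface measure of the unit sphere). -/
def area (p : Space3) (P : SphericalPolygon n R) : ℝ :=
  R ^ 2 * ∫ x : Metric.sphere (0 : Space3) 1,
    P.windingNumber p (R • (x : Space3)) ∂(MeasureTheory.volume : MeasureTheory.Measure Space3).toSphere

/-- The vertices lie on a circle. -/
def IsCyclic (P : SphericalPolygon n R) : Prop :=
  EuclideanGeometry.Concyclic (Set.range P.vertex)

/-- The polygon lies on a great circle. -/
def OnGreatCircle (P : SphericalPolygon n R) : Prop :=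
  ∃ m : Space3, m ≠ 0 ∧ ∀ i, inner ℝ m (P.vertex i) = 0

/-- Spherical polygons with the same edge lengths as `P` that are `ε`-close to `P`. -/
def NearbyPolygon (P : SphericalPolygon n R) (ε : ℝ) : Type :=
  {Q : SphericalPolygon n R //
    (∀ i, Q.edgeLength i = P.edgeLength i) ∧ ∀ i, dist (Q.vertex i) (P.vertex i) < ε}

/-- Two nearby polygons are identified if they differ by a rotation of the sphere. -/
def rotationSetoid (P : SphericalPolygon n R) (ε : ℝ) : Setoid (P.NearbyPolygon ε) where
  r Q Q' := ∃ ρ : Space3 ≃ₗᵢ[ℝ] Space3, IsRotation ρ ∧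
    ∀ i, Q'.1.vertex i = ρ (Q.1.vertex i)
  iseqv := by
    refine ⟨fun Q => ⟨LinearIsometryEquiv.refl ℝ Space3, ?_, fun i => rfl⟩, ?_, ?_⟩
    · exact LinearMap.det_id
    · rintro Q Q' ⟨ρ, hρ, h⟩
      refine ⟨ρ.symm, ?_, fun i => by rw [h i]; simp⟩
      have h1 := LinearEquiv.det_symm_mul_det ρ.toLinearEquiv
      unfold IsRotation at hρ ⊢
      rw [hρ, mul_one] at h1
      exact h1
    · rintro Q Q' Q'' ⟨ρ, hρ, h⟩ ⟨τ, hτ, h'⟩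
      refine ⟨ρ.trans τ, ?_, fun i => by rw [h' i, h i]; rfl⟩
      unfold IsRotation at hρ hτ ⊢
      have h1 := LinearMap.det_comp (τ.toLinearEquiv : Space3 →ₗ[ℝ] Space3)
        (ρ.toLinearEquiv : Space3 →ₗ[ℝ] Space3)
      rw [hρ, hτ, mul_one] at h1
      exact h1

/-- The local configuration space of `P` (of size `ε`): the spherical polygons with the edge
lengths of `P` that are `ε`-close to `P`, modulo rotations of the sphere. -/
def LocalConfig (P : SphericalPolygon n R) (ε : ℝ) : Type :=
  Quotient (P.rotationSetoid ε)

/-- The point of the local configuration space of `P` that a nearby polygon represents. -/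
def NearbyPolygon.toLocalConfig {P : SphericalPolygon n R} {ε : ℝ} (Q : P.NearbyPolygon ε) :
    P.LocalConfig ε :=
  Quotient.mk (P.rotationSetoid ε) Q

/-- `P` is a critical point of the function `F` on its local configuration space: the derivative
of `F` vanishes at `P` along every differentiable curve through `P`. A curve is given
by a family of polygons whose vertices depend differentiably on the parameter. -/
def IsCriticalPoint (P : SphericalPolygon n R) (ε : ℝ) (F : P.LocalConfig ε → ℝ) : Prop :=
  ∀ γ : ℝ → P.NearbyPolygon ε, (γ 0).1 = P →
    DifferentiableAt ℝ (fun t => (γ t).1.vertex) 0 →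
    HasDerivAt (fun t => F (γ t).toLocalConfig) 0 0

end SphericalPolygon

end

noncomputable section

/-! ### Algebra of triple products -/

/-! Everything is rescaled to the unit sphere, with `p` the direction of the puncture and `u i` the
unit vertices. In the stereographic chart at `p` the angle form around `x` is half the difference of
two vortices, one at `x` and one at `p` (`angleForm_eq_vortexForm`). Integrated over `x`, the vortex
at `x` contributes nothing by reflection symmetry, so the area is a constant times the line integral
of `det3 c y y' / (1 + ⟪c, y⟫)` with centre `c = -p` (`area_eq_sum_areaIntegral`).

Two such forms with different centres differ by an exact form whose potential is a spherical
triangle area, as long as `excessRe` stays positive along the curve. On a closed polygon the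
potentials telescope, so the centre may be moved: from `-p` to the centre `e` of the hemisphere, and
from `e` to its image under a rotation, which gives well-definedness. Centred at `e`, the area is a
constant times the sum of the triangle areas `(e, u i, u (i + 1))`.

In the derivative of that sum the terms containing `e` cancel, and each edge leaves `edgeVariation`.
If all `⟪m, u i⟫ = 1`, these terms telescope to zero (`edgeVariation_of_plane`). Conversely, a
relation `∑ l i • u i = 0` produces a flex in which each edge rotates rigidly; its first variation
is `-∑ l i`, so stationarity says that `∑ l i` vanishes on all relations. By duality such an `m`
exists (`exists_plane_of_stationary`). Since `P` is not on a great circle, the edge data are a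
submersion at `P`, and every flex is tangent to a genuine family (`exists_deformation`). -/

theorem inner_space3 (a b : Space3) : inner ℝ a b = a 0 * b 0 + a 1 * b 1 + a 2 * b 2 := by
  simp [PiLp.inner_apply, Fin.sum_univ_three]
  ring

theorem det3_expand (a b c : Space3) :
    det3 a b c = a 0 * (b 1 * c 2 - b 2 * c 1) - a 1 * (b 0 * c 2 - b 2 * c 0)
      + a 2 * (b 0 * c 1 - b 1 * c 0) := by
  simp [det3, Matrix.det_fin_three]
  ring

theorem det3_smul_right (r : ℝ) (a b c : Space3) : det3 a b (r • c) = r * det3 a b c := by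
  simp only [det3_expand, PiLp.smul_apply, smul_eq_mul]; ring

theorem det3_add_mid (a b c d : Space3) : det3 a (b + c) d = det3 a b d + det3 a c d := by
  simp only [det3_expand, PiLp.add_apply]; ring

theorem det3_smul_mid (r : ℝ) (a b c : Space3) : det3 a (r • b) c = r * det3 a b c := by
  simp only [det3_expand, PiLp.smul_apply, smul_eq_mul]; ring

theorem det3_add_left (a b c d : Space3) : det3 (a + b) c d = det3 a c d + det3 b c d := by
  simp only [det3_expand, PiLp.add_apply]; ring

theorem det3_smul_left (r : ℝ) (a b c : Space3) : det3 (r • a) b c = r * det3 a b c := by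
  simp only [det3_expand, PiLp.smul_apply, smul_eq_mul]; ring

theorem det3_neg_left (a b c : Space3) : det3 (-a) b c = -det3 a b c := by
  simp only [det3_expand, PiLp.neg_apply]; ring

theorem det3_cycle (a b c : Space3) : det3 a b c = det3 b c a := by
  simp only [det3_expand]; ring

@[simp] theorem det3_self_left (a b : Space3) : det3 a a b = 0 := by
  simp only [det3_expand]; ring

@[simp] theorem det3_self_right (a b : Space3) : det3 a b b = 0 := by
  simp only [det3_expand]; ring

@[simp] theorem det3_self_outer (a b : Space3) : det3 a b a = 0 := by
  simp only [det3_expand]; ring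

/-- Four vectors of `ℝ³` satisfy Cramer's linear relation; here it is paired with `q`. The
identities below are combinations of its instances. -/
theorem cramer_inner (p x y z q : Space3) :
    inner ℝ p q * det3 x y z - inner ℝ x q * det3 p y z + inner ℝ y q * det3 p x z
      - inner ℝ z q * det3 p x y = 0 := by
  simp only [det3_expand, inner_space3]; ring

theorem det3_sq (a b c : Space3) :
    det3 a b c ^ 2 = inner ℝ a a * (inner ℝ b b * inner ℝ c c - inner ℝ b c ^ 2)
      - inner ℝ a b * (inner ℝ a b * inner ℝ c c - inner ℝ b c * inner ℝ a c)
      + inner ℝ a c * (inner ℝ a b * inner ℝ b c - inner ℝ b b * inner ℝ a c) := by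
  simp only [det3_expand, inner_space3]; ring

theorem inner_self_of_norm_one {a : Space3} (h : ‖a‖ = 1) : inner ℝ a a = (1 : ℝ) := by
  rw [real_inner_self_eq_norm_sq, h]; norm_num

/-- The cross product of `ℝ³`. -/
def cross3 (a b : Space3) : Space3 :=
  !₂[a 1 * b 2 - a 2 * b 1, a 2 * b 0 - a 0 * b 2, a 0 * b 1 - a 1 * b 0]

theorem inner_cross3 (a b c : Space3) : inner ℝ a (cross3 b c) = det3 a b c := by
  simp only [det3_expand, inner_space3, cross3]
  simp
  ring

theorem inner_cross3_self (b c : Space3) :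
    inner ℝ (cross3 b c) (cross3 b c)
      = inner ℝ b b * inner ℝ c c - (inner ℝ b c : ℝ) ^ 2 := by
  rw [inner_cross3, det3_expand]
  simp only [cross3, inner_space3]
  simp
  ring

theorem ext_inner_space3 {a b : Space3} (h : ∀ v : Space3, inner ℝ v a = inner ℝ v b) : a = b :=
  ext_inner_left ℝ h

/-- The sum of the angles of the spherical triangle `a b c`, minus `π`, is twice the argument of
the complex number with this real part and imaginary part `det3 a b c`. -/
def excessRe (a b c : Space3) : ℝ := 1 + inner ℝ a b + inner ℝ a c + inner ℝ b c

/-- The squared determinant is the Gram determinant. The factorisation is what makes the derivative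
of the arctangent in `triangleArea` split into simple fractions. -/
theorem excess_norm_sq {a b c : Space3} (ha : ‖a‖ = 1) (hb : ‖b‖ = 1) (hc : ‖c‖ = 1) :
    excessRe a b c ^ 2 + det3 a b c ^ 2
      = 2 * (1 + inner ℝ a b) * (1 + inner ℝ a c) * (1 + inner ℝ b c) := by
  rw [det3_sq, inner_self_of_norm_one ha, inner_self_of_norm_one hb, inner_self_of_norm_one hc,
    excessRe]
  ring

/-- The left side is the numerator of the derivative of `det3 / excessRe` when only `y` moves, with
velocity `w`; the right side cancels against `excess_norm_sq`. -/
theorem excess_deriv_identity {c a y w : Space3} (hc : ‖c‖ = 1) (ha : ‖a‖ = 1) (hy : ‖y‖ = 1)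
    (hw : inner ℝ y w = 0) :
    det3 c a w * excessRe c a y - det3 c a y * (inner ℝ c w + inner ℝ a w)
      = (1 + inner ℝ c a) * ((1 + inner ℝ a y) * det3 c y w - (1 + inner ℝ c y) * det3 a y w) := by
  have h1 := cramer_inner c a y w c
  have h2 := cramer_inner c a y w a
  have h3 := cramer_inner c a y w y
  rw [inner_self_of_norm_one hc, real_inner_comm c a, real_inner_comm c y,
    real_inner_comm c w] at h1
  rw [inner_self_of_norm_one ha, real_inner_comm a y, real_inner_comm a w] at h2
  rw [inner_self_of_norm_one hy, real_inner_comm y w, hw] at h3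
  rw [excessRe]
  linear_combination h1 + h2 + (1 + inner ℝ c a) * h3

/-- The left side is, up to a common factor, the numerator of the angle form pulled back through the
chart. -/
theorem vortex_identity {p x y w : Space3} (hp : ‖p‖ = 1) (hy : ‖y‖ = 1)
    (hw : inner ℝ y w = 0) :
    -(1 - inner ℝ p x) * det3 p y w + (1 - inner ℝ p y) * det3 p x w + inner ℝ p w * det3 p x y
      = (1 - inner ℝ p y) * det3 x y w - (1 - inner ℝ x y) * det3 p y w := by
  have h1 := cramer_inner p x y w p
  have h3 := cramer_inner p x y w y
  rw [inner_self_of_norm_one hp, real_inner_comm p x, real_inner_comm p y,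
    real_inner_comm p w] at h1
  rw [inner_self_of_norm_one hy, real_inner_comm y w, hw] at h3
  linear_combination -h1 + h3

end

noncomputable section

/-! ### Stereographic projection -/

theorem stereo_smul {R : ℝ} (hR : R ≠ 0) (p x : Space3) :
    stereo R (R • p) (R • x) = R • stereo 1 p x := by
  have h : R ^ 2 / (R ^ 2 - R * (R * inner ℝ p x)) = 1 / (1 - inner ℝ p x) := by
    rw [← mul_assoc, ← pow_two, ← mul_one_sub, div_mul_eq_div_div, div_self (pow_ne_zero 2 hR)]
  simp only [stereo, real_inner_smul_left, real_inner_smul_right, h, one_pow]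
  module

theorem stereo_one (p x : Space3) : stereo 1 p x = p + (1 - inner ℝ p x)⁻¹ • (x - p) := by
  simp [stereo]

theorem hasDerivAt_stereo {p : Space3} {y : ℝ → Space3} {w : Space3} {t : ℝ}
    (hy : HasDerivAt y w t) (hp : 1 - inner ℝ p (y t) ≠ 0) :
    HasDerivAt (fun s => stereo 1 p (y s))
      ((1 - inner ℝ p (y t))⁻¹ • w
        + (inner ℝ p w / (1 - inner ℝ p (y t)) ^ 2) • (y t - p)) t := by
  simp only [stereo_one]
  have h1 : HasDerivAt (fun s => 1 - inner ℝ p (y s)) (-inner ℝ p w) t := by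
    simpa using ((hasDerivAt_const t p).inner ℝ hy).const_sub 1
  have h2 := ((h1.fun_inv hp).smul (hy.sub_const p)).const_add p
  simpa [neg_div] using h2

theorem norm_stereo_sub_sq {p x y : Space3} (hp : ‖p‖ = 1) (hx : ‖x‖ = 1) (hy : ‖y‖ = 1)
    (hpx : 1 - inner ℝ p x ≠ 0) (hpy : 1 - inner ℝ p y ≠ 0) :
    ‖stereo 1 p y - stereo 1 p x‖ ^ 2
      = 2 * (1 - inner ℝ x y) / ((1 - inner ℝ p x) * (1 - inner ℝ p y)) := by
  rw [← real_inner_self_eq_norm_sq, stereo_one, stereo_one]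
  simp only [add_sub_add_left_eq_sub, inner_sub_left, inner_sub_right, real_inner_smul_left,
    real_inner_smul_right, inner_self_of_norm_one hp, inner_self_of_norm_one hx,
    inner_self_of_norm_one hy, real_inner_comm p x, real_inner_comm p y, real_inner_comm x y]
  field_simp
  ring

theorem det3_neg_vortex (p x y w : Space3) (α β γ : ℝ) :
    det3 (-p) (β • (y - p) - α • (x - p)) (β • w + γ • (y - p))
      = -(β ^ 2 * det3 p y w - α * β * det3 p x w - α * γ * det3 p x y) := by
  simp only [det3_expand, PiLp.neg_apply, PiLp.add_apply, PiLp.sub_apply, PiLp.smul_apply,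
    smul_eq_mul]
  ring

/-- The angle form around `x` in the stereographic chart at `p`, in three-dimensional terms. -/
def vortexForm (p x y w : Space3) : ℝ :=
  (det3 x y w / (1 - inner ℝ x y) - det3 p y w / (1 - inner ℝ p y)) / 2

theorem angleForm_eq_vortexForm {p x : Space3} {y : ℝ → Space3} {w : Space3} {t : ℝ}
    (hp : ‖p‖ = 1) (hx : ‖x‖ = 1) (hyn : ‖y t‖ = 1) (hy : HasDerivAt y w t)
    (hw : inner ℝ (y t) w = 0)
    (hpx : inner ℝ p x ≠ 1) (hpy : inner ℝ p (y t) ≠ 1) (hxy : inner ℝ x (y t) ≠ 1) :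
    det3 (-p) (stereo 1 p (y t) - stereo 1 p x) (deriv (fun s => stereo 1 p (y s)) t)
      / ‖stereo 1 p (y t) - stereo 1 p x‖ ^ 2 = vortexForm p x (y t) w := by
  have hpx' : 1 - inner ℝ p x ≠ 0 := sub_ne_zero.2 hpx.symm
  have hpy' : 1 - inner ℝ p (y t) ≠ 0 := sub_ne_zero.2 hpy.symm
  have hxy' : 1 - inner ℝ x (y t) ≠ 0 := sub_ne_zero.2 hxy.symm
  have key := vortex_identity (x := x) hp hyn hw
  rw [(hasDerivAt_stereo hy hpy').deriv, norm_stereo_sub_sq hp hx hyn hpx' hpy', stereo_one,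
    stereo_one, vortexForm]
  rw [add_sub_add_left_eq_sub, det3_neg_vortex]
  field_simp
  linear_combination key

end

noncomputable section

/-! ### The surface measure of the unit sphere -/

open MeasureTheory Metric Set Pointwise in
-- The sphere measure of a set is a multiple of the volume of the cone over it, and `L` maps cones
-- to cones and preserves volume.
theorem measurePreserving_toSphere_of_coe (L : Space3 ≃ₗᵢ[ℝ] Space3)
    {f : sphere (0 : Space3) 1 → sphere (0 : Space3) 1} (hf : ∀ x, (f x : Space3) = L x) :
    MeasurePreserving f (volume : Measure Space3).toSphere (volume : Measure Space3).toSphere := by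
  have hfm : Measurable f := by
    refine Measurable.subtype_mk (f := fun x => (f x : Space3)) ?_ (h := fun x => (f x).2)
    simp only [hf]
    exact L.continuous.measurable.comp measurable_subtype_coe
  refine ⟨hfm, Measure.ext fun s hs => ?_⟩
  rw [Measure.map_apply hfm hs, Measure.toSphere_apply' _ (hfm hs), Measure.toSphere_apply' _ hs,
    ← L.measurePreserving.measure_preimage_emb L.toHomeomorph.measurableEmbedding
      (Ioo (0 : ℝ) 1 • (Subtype.val '' s))]
  congr 2
  ext z
  simp only [mem_smul, mem_image, mem_preimage]
  constructor
  · rintro ⟨r, hr, _, ⟨x, hx, rfl⟩, rfl⟩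
    exact ⟨r, hr, _, ⟨f x, hx, rfl⟩, by rw [hf, map_smul]⟩
  · rintro ⟨r, hr, _, ⟨x, hx, rfl⟩, h⟩
    have hfx : f ⟨L.symm x, by simp⟩ = x := Subtype.ext (by rw [hf]; simp)
    refine ⟨r, hr, _, ⟨⟨L.symm x, by simp⟩, by rwa [hfx], rfl⟩, ?_⟩
    apply L.injective
    rw [← h, map_smul]
    simp

open MeasureTheory Metric Set Pointwise in
theorem toSphere_singleton (x : sphere (0 : Space3) 1) :
    (volume : Measure Space3).toSphere {x} = 0 := by
  rw [Measure.toSphere_apply' _ (measurableSet_singleton x), image_singleton]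
  have hs : (Submodule.span ℝ {(x : Space3)}) ≠ ⊤ := by
    intro h
    have := finrank_span_singleton (K := ℝ) (v := (x : Space3)) (by
      intro h0; have := x.2; rw [h0] at this; simp at this)
    rw [h, finrank_top] at this
    simp at this
  have h0 := Measure.addHaar_submodule (volume : Measure Space3) _ hs
  rw [measure_mono_null _ h0, mul_zero]
  rintro _ ⟨r, -, y, rfl, rfl⟩
  exact Submodule.smul_mem _ _ (Submodule.mem_span_singleton_self _)

open MeasureTheory Metric Set in
/-- An isometry acting on the sphere, as a measurable equivalence. -/
def sphereEquiv (L : Space3 ≃ₗᵢ[ℝ] Space3) :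
    sphere (0 : Space3) 1 ≃ᵐ sphere (0 : Space3) 1 where
  toFun x := ⟨L x, by simp⟩
  invFun x := ⟨L.symm x, by simp⟩
  left_inv x := by simp
  right_inv x := by simp
  measurable_toFun :=
    (L.continuous.measurable.comp measurable_subtype_coe).subtype_mk
  measurable_invFun :=
    (L.symm.continuous.measurable.comp measurable_subtype_coe).subtype_mk

open MeasureTheory Metric Set in
theorem measurePreserving_sphereEquiv (L : Space3 ≃ₗᵢ[ℝ] Space3) :
    MeasurePreserving (sphereEquiv L) (volume : Measure Space3).toSphere
      (volume : Measure Space3).toSphere :=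
  measurePreserving_toSphere_of_coe L fun _ => rfl

open MeasureTheory Metric Set in
/-- The flux of a vortex, averaged over the position of the vortex, vanishes by symmetry. -/
theorem integral_det3_div_eq_zero (y w : Space3) :
    ∫ x : sphere (0 : Space3) 1, det3 x y w / (1 - inner ℝ (x : Space3) y)
      ∂(volume : Measure Space3).toSphere = 0 := by
  -- Reflection in the plane of `y` and `w` fixes `y` and reverses the sign of the integrand. The
  -- argument also covers `ν = 0`.
  set ν := cross3 y w with hν
  set L := (ℝ ∙ ν)ᗮ.reflection with hL
  have hy : L y = y := by
    apply Submodule.reflection_mem_subspace_eq_self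
    rw [Submodule.mem_orthogonal_singleton_iff_inner_left, inner_cross3]
    simp
  have hν' : L ν = -ν := Submodule.reflection_orthogonalComplement_singleton_eq_neg ν
  have key : ∀ x : Space3, det3 (L x) y w = - det3 x y w := by
    intro x
    rw [← inner_cross3, ← inner_cross3, ← hν, ← L.inner_map_map, Submodule.reflection_reflection,
      hν', inner_neg_right]
  have h := (measurePreserving_sphereEquiv L).integral_comp' (fun x : sphere (0 : Space3) 1 =>
    det3 x y w / (1 - inner ℝ (x : Space3) y))
  have h2 : ∀ x : sphere (0 : Space3) 1, inner ℝ (sphereEquiv L x : Space3) y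
      = inner ℝ (x : Space3) y := by
    intro x
    conv_lhs => rw [← hy]
    exact L.inner_map_map x y
  have h3 : ∀ x : sphere (0 : Space3) 1, det3 (sphereEquiv L x : Space3) y w = - det3 x y w :=
    fun x => key x
  simp only [h2, h3, neg_div, integral_neg] at h
  linarith

open MeasureTheory Metric Set in
-- A product majorant for the singularity `1 / ‖x - e‖` at the pole, chosen so that integrability
-- reduces to `|t| ^ (-1/2)` in one variable.
theorem integrable_singular_box :
    Integrable (fun z : Space3 => ∏ i, (![(ball (0 : ℝ) 1).indicator fun t => ‖t‖ ^ (-(1 / 2) : ℝ),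
      (ball (0 : ℝ) 1).indicator fun t => ‖t‖ ^ (-(1 / 2) : ℝ),
      (ball (0 : ℝ) 1).indicator fun _ => 1] : Fin 3 → ℝ → ℝ) i (z i)) := by
  have h1 : Integrable ((ball (0 : ℝ) 1).indicator fun t => ‖t‖ ^ (-(1 / 2) : ℝ)) := by
    rw [integrable_indicator_iff measurableSet_ball,
      integrableOn_fun_norm_addHaar volume (f := fun t : ℝ => t ^ (-(1 / 2) : ℝ))]
    simp only [Module.finrank_self, Nat.sub_self, pow_zero, one_smul]
    exact ((intervalIntegral.intervalIntegrable_rpow' (a := 0) (b := 1) (by norm_num)).1).mono_set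
      Ioo_subset_Ioc_self
  have h2 : Integrable ((ball (0 : ℝ) 1).indicator fun _ => (1 : ℝ)) := by
    rw [integrable_indicator_iff measurableSet_ball]
    exact integrableOn_const (by simp)
  have h3 : Integrable (fun z : Fin 3 → ℝ => ∏ i,
      (![(ball (0 : ℝ) 1).indicator fun t => ‖t‖ ^ (-(1 / 2) : ℝ),
      (ball (0 : ℝ) 1).indicator fun t => ‖t‖ ^ (-(1 / 2) : ℝ),
      (ball (0 : ℝ) 1).indicator fun _ => 1] : Fin 3 → ℝ → ℝ) i (z i)) := by
    apply Integrable.fintype_prod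
    intro i
    fin_cases i
    · exact h1
    · exact h1
    · exact h2
  exact (PiLp.volume_preserving_ofLp (Fin 3)).integrable_comp_of_integrable h3

theorem sqrt_mul_sqrt_le_norm_sub {z : Space3} (h0 : z ≠ 0) (h1 : ‖z‖ < 1) :
    √|z 0| * √|z 1| ≤ ‖‖z‖⁻¹ • z - EuclideanSpace.single 2 1‖ := by
  rw [← Real.sqrt_mul (abs_nonneg _), EuclideanSpace.norm_eq]
  apply Real.sqrt_le_sqrt
  have hn : 0 < ‖z‖ := norm_pos_iff.2 h0
  have hi : 1 ≤ ‖z‖⁻¹ := (one_le_inv₀ hn).2 h1.le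
  simp [Fin.sum_univ_three, -norm_inv, -inv_pow, mul_pow]
  have hi2 : 1 ≤ (‖z‖⁻¹) ^ 2 := by nlinarith
  nlinarith [sq_nonneg (|z 0| - |z 1|), sq_abs (z 0), sq_abs (z 1), sq_nonneg (z 0),
    sq_nonneg (z 1), sq_nonneg (‖z‖⁻¹ * z 2 - 1), abs_nonneg (z 0), abs_nonneg (z 1)]

open MeasureTheory Metric Set in
-- In polar coordinates the sphere integral, times a positive radial factor, is the integral over
-- the unit ball of the radially constant extension, which `sqrt_mul_sqrt_le_norm_sub` bounds by the
-- product majorant.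
theorem lintegral_inv_norm_sub_pole_lt_top :
    ∫⁻ x : sphere (0 : Space3) 1, ‖(x : Space3) - EuclideanSpace.single 2 1‖ₑ⁻¹
      ∂(volume : Measure Space3).toSphere < ⊤ := by
  set e : Space3 := EuclideanSpace.single 2 1 with he
  set ν := Measure.volumeIoiPow (Module.finrank ℝ Space3 - 1)
  set I : Set (Ioi (0 : ℝ)) := Iio ⟨1, mem_Ioi.2 one_pos⟩
  have hF : Measurable fun x : sphere (0 : Space3) 1 => ‖(x : Space3) - e‖ₑ⁻¹ := by fun_prop
  have h := (volume : Measure Space3).measurePreserving_homeomorphUnitSphereProd.lintegral_comp_emb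
    (Homeomorph.measurableEmbedding _)
    (fun q => ‖(q.1 : Space3) - e‖ₑ⁻¹ * I.indicator 1 q.2)
  rw [lintegral_prod_mul hF.aemeasurable
    (measurable_one.indicator measurableSet_Iio).aemeasurable,
    lintegral_indicator_one measurableSet_Iio] at h
  have hν : ν I = ENNReal.ofReal (1 / 3) := by
    rw [Measure.volumeIoiPow_apply_Iio]
    norm_num
  have hfin : ∫⁻ z : ({0}ᶜ : Set Space3), ‖((homeomorphUnitSphereProd Space3 z).1 : Space3) - e‖ₑ⁻¹
      * I.indicator 1 (homeomorphUnitSphereProd Space3 z).2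
      ∂(volume : Measure Space3).comap (↑) < ⊤ := by
    have hG : ∀ z : ({0}ᶜ : Set Space3),
        ‖((homeomorphUnitSphereProd Space3 z).1 : Space3) - e‖ₑ⁻¹
          * I.indicator 1 (homeomorphUnitSphereProd Space3 z).2
        = ‖‖(z : Space3)‖⁻¹ • (z : Space3) - e‖ₑ⁻¹ * (ball 0 1).indicator 1 (z : Space3) := by
      intro z
      rw [homeomorphUnitSphereProd_apply_fst_coe]
      congr 1
      have hz : (homeomorphUnitSphereProd Space3 z).2 ∈ I ↔ (z : Space3) ∈ ball (0 : Space3) 1 := by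
        rw [mem_ball_zero_iff, ← homeomorphUnitSphereProd_apply_snd_coe]
        exact Iff.rfl
      by_cases hb : (z : Space3) ∈ ball (0 : Space3) 1
      · rw [indicator_of_mem hb, indicator_of_mem (hz.2 hb)]; rfl
      · rw [indicator_of_notMem hb, indicator_of_notMem (mt hz.1 hb)]
    simp only [hG]
    rw [lintegral_subtype_comap (measurableSet_singleton (0 : Space3)).compl
      (fun z => ‖‖z‖⁻¹ • z - e‖ₑ⁻¹ * (ball 0 1).indicator 1 z)]
    refine lt_of_le_of_lt ?_ integrable_singular_box.2
    refine le_trans ?_ (setLIntegral_le_lintegral ({0}ᶜ : Set Space3) _)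
    have hae : ∀ i : Fin 3, ∀ᵐ z : Space3, z i ≠ 0 := fun i =>
      (PiLp.volume_preserving_ofLp (Fin 3)).quasiMeasurePreserving.ae
        (Measure.ae_eval_ne (μ := fun _ => volume) i 0)
    refine lintegral_mono_ae ?_
    filter_upwards [ae_restrict_mem (measurableSet_singleton (0 : Space3)).compl,
      ae_restrict_of_ae (hae 0), ae_restrict_of_ae (hae 1)] with z hz hz0 hz1
    by_cases hb : z ∈ ball (0 : Space3) 1
    swap
    · simp [hb]
    have hzn : ‖z‖ < 1 := by simpa using hb
    have hzi : ∀ i, z i ∈ ball (0 : ℝ) 1 := fun i => by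
      rw [mem_ball_zero_iff]
      exact (PiLp.norm_apply_le z i).trans_lt hzn
    have hs := sqrt_mul_sqrt_le_norm_sub hz hzn
    have hpos : 0 < √|z 0| * √|z 1| := by positivity
    simp only [Fin.prod_univ_three, Matrix.cons_val_zero, Matrix.cons_val_one, Matrix.cons_val,
      indicator_of_mem (hzi _), indicator_of_mem hb, mul_one, Pi.one_apply]
    rw [Real.rpow_neg (norm_nonneg _), Real.rpow_neg (norm_nonneg _), ← Real.sqrt_eq_rpow,
      ← Real.sqrt_eq_rpow, ← mul_inv, ← ofReal_norm, ← ofReal_norm,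
      ← ENNReal.ofReal_inv_of_pos (hpos.trans_le hs), norm_inv, Real.norm_of_nonneg (by positivity)]
    exact ENNReal.ofReal_le_ofReal (inv_anti₀ hpos hs)
  rw [h, hν] at hfin
  exact ENNReal.lt_top_of_mul_ne_top_left hfin.ne (by simp)

open MeasureTheory Metric Set in
theorem lintegral_inv_norm_sub_eq {y : Space3} (hy : ‖y‖ = 1) :
    ∫⁻ x : sphere (0 : Space3) 1, ‖(x : Space3) - y‖ₑ⁻¹ ∂(volume : Measure Space3).toSphere
      = ∫⁻ x : sphere (0 : Space3) 1, ‖(x : Space3) - EuclideanSpace.single 2 1‖ₑ⁻¹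
        ∂(volume : Measure Space3).toSphere := by
  set e : Space3 := EuclideanSpace.single 2 1 with he
  set L := (ℝ ∙ (e - y))ᗮ.reflection
  have hL : L e = y := Submodule.reflection_sub (by rw [hy, he]; simp)
  rw [← (measurePreserving_sphereEquiv L).lintegral_comp_emb
    (sphereEquiv L).measurableEmbedding]
  congr 1 with x
  have : ((sphereEquiv L x : sphere (0 : Space3) 1) : Space3) - y = L (x - e) := by
    rw [map_sub, hL]; rfl
  rw [this, L.enorm_map]

end

noncomputable section

/-! ### Geodesic arcs of the unit sphere -/

/-- The two unit vectors are neither equal nor antipodal. -/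
structure IsArc (a b : Space3) : Prop where
  norm_left : ‖a‖ = 1
  norm_right : ‖b‖ = 1
  neg_one_lt : -1 < (inner ℝ a b : ℝ)
  lt_one : (inner ℝ a b : ℝ) < 1

theorem geodesicArc_smul {R : ℝ} (hR : 0 < R) (a b : Space3) (t : ℝ) :
    geodesicArc R (R • a) (R • b) t = R • geodesicArc 1 a b t := by
  have : (1 - t) • R • a + t • R • b = R • ((1 - t) • a + t • b) := by module
  rw [geodesicArc, geodesicArc, this, norm_smul, Real.norm_of_nonneg hR.le, smul_comm R,
    div_mul_cancel_left₀ hR.ne', one_div]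

namespace IsArc

variable {a b : Space3}

theorem norm_chord_sq (h : IsArc a b) (t : ℝ) :
    ‖(1 - t) • a + t • b‖ ^ 2 = 1 - 2 * t * (1 - t) * (1 - inner ℝ a b) := by
  rw [← real_inner_self_eq_norm_sq]
  simp only [inner_add_left, inner_add_right, real_inner_smul_left, real_inner_smul_right,
    inner_self_of_norm_one h.norm_left, inner_self_of_norm_one h.norm_right, real_inner_comm a b]
  ring

theorem chord_ne_zero (h : IsArc a b) (t : ℝ) : (1 - t) • a + t • b ≠ 0 := by
  intro h0
  have := h.norm_chord_sq t
  rw [h0, norm_zero] at this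
  nlinarith [h.neg_one_lt, h.lt_one, mul_nonneg (sq_nonneg (1 - 2 * t)) (sub_nonneg.2 h.lt_one.le)]

theorem norm_arc (h : IsArc a b) (t : ℝ) : ‖geodesicArc 1 a b t‖ = 1 := by
  rw [geodesicArc, norm_smul, norm_div, norm_norm, norm_one,
    div_mul_cancel₀ _ (norm_ne_zero_iff.2 (h.chord_ne_zero t))]

theorem contDiff_arc (h : IsArc a b) : ContDiff ℝ 1 (geodesicArc 1 a b) := by
  have h1 : ContDiff ℝ 1 fun t : ℝ => (1 - t) • a + t • b := by fun_prop
  exact (contDiff_const.div (h1.norm ℝ h.chord_ne_zero)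
    fun t => norm_ne_zero_iff.2 (h.chord_ne_zero t)).smul h1

theorem hasDerivAt_arc (h : IsArc a b) (t : ℝ) :
    HasDerivAt (geodesicArc 1 a b) (deriv (geodesicArc 1 a b) t) t :=
  (h.contDiff_arc.differentiable one_ne_zero t).hasDerivAt

theorem continuous_deriv_arc (h : IsArc a b) : Continuous (deriv (geodesicArc 1 a b)) :=
  h.contDiff_arc.continuous_deriv le_rfl

theorem inner_deriv_arc (h : IsArc a b) (t : ℝ) :
    inner ℝ (geodesicArc 1 a b t) (deriv (geodesicArc 1 a b) t) = 0 := by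
  have h1 := (h.hasDerivAt_arc t).inner ℝ (h.hasDerivAt_arc t)
  have h2 : (fun t => (inner ℝ (geodesicArc 1 a b t) (geodesicArc 1 a b t) : ℝ)) = fun _ => 1 :=
    funext fun t => inner_self_of_norm_one (h.norm_arc t)
  rw [h2, real_inner_comm (geodesicArc 1 a b t)] at h1
  have := h1.unique (hasDerivAt_const t 1)
  linarith

theorem arc_zero (h : IsArc a b) : geodesicArc 1 a b 0 = a := by
  simp [geodesicArc, h.norm_left]

theorem arc_one (h : IsArc a b) : geodesicArc 1 a b 1 = b := by
  simp [geodesicArc, h.norm_right]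

/-- The arc stays in the plane of `a` and `b`. Hence the area form centred at `a` vanishes along it.
-/
theorem det3_deriv_arc (h : IsArc a b) (t : ℝ) :
    det3 a (geodesicArc 1 a b t) (deriv (geodesicArc 1 a b) t) = 0 := by
  have h1 : HasDerivAt (fun s => inner ℝ (cross3 a b) (geodesicArc 1 a b s))
      (inner ℝ (cross3 a b) (deriv (geodesicArc 1 a b) t)) t := by
    simpa using (hasDerivAt_const t (cross3 a b)).inner ℝ (h.hasDerivAt_arc t)
  have h2 : (fun s => (inner ℝ (cross3 a b) (geodesicArc 1 a b s) : ℝ)) = fun _ => 0 := by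
    funext s
    rw [real_inner_comm, inner_cross3, geodesicArc]
    simp [det3_smul_left, det3_add_left]
  rw [h2] at h1
  have h3 := h1.unique (hasDerivAt_const t 0)
  rw [real_inner_comm, inner_cross3, det3_cycle] at h3
  rw [geodesicArc, det3_smul_mid, det3_add_mid, det3_smul_mid, det3_smul_mid, det3_self_left, h3]
  ring

/-- A point of the arc is a conical combination of the end points with bounded coefficients. -/
theorem exists_coeff (h : IsArc a b) {t : ℝ} (ht : t ∈ Set.Icc (0 : ℝ) 1) :
    ∃ α β : ℝ, 0 ≤ α ∧ 0 ≤ β ∧ geodesicArc 1 a b t = α • a + β • b ∧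
      α ^ 2 + β ^ 2 + 2 * α * β * inner ℝ a b = 1 := by
  refine ⟨1 / ‖(1 - t) • a + t • b‖ * (1 - t), 1 / ‖(1 - t) • a + t • b‖ * t,
    mul_nonneg (by positivity) (by linarith [ht.2]), mul_nonneg (by positivity) ht.1, ?_, ?_⟩
  · rw [geodesicArc]; module
  · have h1 := h.norm_chord_sq t
    have h2 := norm_ne_zero_iff.2 (h.chord_ne_zero t)
    field_simp
    rw [h1]; ring

theorem inner_le_inner_arc (h : IsArc a b) {t : ℝ} (ht : t ∈ Set.Icc (0 : ℝ) 1) :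
    (inner ℝ a b : ℝ) ≤ inner ℝ a (geodesicArc 1 a b t) := by
  obtain ⟨α, β, hα, hβ, he, hn⟩ := h.exists_coeff ht
  rw [he, inner_add_right, real_inner_smul_right, real_inner_smul_right,
    inner_self_of_norm_one h.norm_left]
  have hk1 := h.neg_one_lt
  have hk2 := h.lt_one
  set k : ℝ := inner ℝ a b
  have h1 : 1 ≤ α + β := by nlinarith [mul_nonneg hα hβ]
  rcases le_or_gt β 1 with hb | hb
  · nlinarith
  rcases le_or_gt 0 k with hk | hk
  · nlinarith
  -- The left side is the inner product of the arc point with `b`, both unit vectors.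
  have h2 : β + α * k ≤ 1 := by
    have hk2 : 0 ≤ 1 - k ^ 2 := by nlinarith
    have : (β + α * k) ^ 2 ≤ 1 := by nlinarith [mul_nonneg (sq_nonneg α) hk2]
    exact (abs_le_one_iff_mul_self_le_one.2 (by nlinarith) |> abs_le.1).2
  nlinarith

/-- An edge can leave the hemisphere further than its end points do, by the factor `α + β ≤ √(2 / (1
+ ⟪a, b⟫))`. The bound `M` depends only on the edge length, so it serves all nearby polygons at
once. -/
theorem neg_le_inner_arc (h : IsArc a b) {t : ℝ} (ht : t ∈ Set.Icc (0 : ℝ) 1) {e : Space3}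
    {δ M : ℝ} (hδ : 0 ≤ δ) (hM : 0 ≤ M) (hMab : 2 ≤ M ^ 2 * (1 + inner ℝ a b))
    (ha : -δ ≤ inner ℝ e a) (hb : -δ ≤ inner ℝ e b) :
    -(M * δ) ≤ inner ℝ e (geodesicArc 1 a b t) := by
  obtain ⟨α, β, hα, hβ, he, hn⟩ := h.exists_coeff ht
  rw [he, inner_add_right, real_inner_smul_right, real_inner_smul_right]
  have hk1 := h.neg_one_lt
  have hk2 := h.lt_one
  set k : ℝ := inner ℝ a b
  have h1 : (1 + k) * (α + β) ^ 2 ≤ 2 := by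
    nlinarith [mul_nonneg (sub_nonneg.2 hk2.le) (sq_nonneg (α - β))]
  have h2 : α + β ≤ M := by
    refine le_of_sq_le_sq ?_ hM
    have h3 : 0 < 1 + k := by linarith
    nlinarith
  nlinarith [mul_le_mul_of_nonneg_left ha hα, mul_le_mul_of_nonneg_left hb hβ]

end IsArc

end

noncomputable section

/-! ### The area as a sum of line integrals -/

theorem norm_cross3_le (b c : Space3) : ‖cross3 b c‖ ≤ ‖b‖ * ‖c‖ := by
  apply le_of_sq_le_sq _ (by positivity)
  rw [mul_pow, ← real_inner_self_eq_norm_sq, ← real_inner_self_eq_norm_sq,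
    ← real_inner_self_eq_norm_sq]
  rw [inner_cross3_self]
  nlinarith [sq_nonneg (inner ℝ b c : ℝ)]

theorem abs_det3_le (a b c : Space3) : |det3 a b c| ≤ ‖a‖ * (‖b‖ * ‖c‖) := by
  rw [← inner_cross3]
  exact (abs_real_inner_le_norm _ _).trans
    (mul_le_mul_of_nonneg_left (norm_cross3_le b c) (norm_nonneg a))

theorem one_sub_inner {x y : Space3} (hx : ‖x‖ = 1) (hy : ‖y‖ = 1) :
    1 - inner ℝ x y = ‖x - y‖ ^ 2 / 2 := by
  rw [norm_sub_sq_real, hx, hy]; ring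

/-- Replacing `x` by `x - y` in the determinant gains one factor `‖x - y‖` against the denominator
`‖x - y‖ ^ 2 / 2`. At `x = y` the quotient is zero by convention. -/
theorem enorm_vortex_le {x y : Space3} (w : Space3) (hx : ‖x‖ = 1) (hy : ‖y‖ = 1) :
    ‖det3 x y w / (1 - inner ℝ x y)‖ₑ ≤ 2 * ‖w‖ₑ * ‖x - y‖ₑ⁻¹ := by
  rcases eq_or_ne x y with rfl | hxy
  · simp
  have hpos : 0 < ‖x - y‖ := norm_pos_iff.2 (sub_ne_zero.2 hxy)
  have h1 : det3 x y w = det3 (x - y) y w := by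
    rw [sub_eq_add_neg, det3_add_left, det3_neg_left, det3_self_left]; ring
  have h2 : ‖det3 x y w / (1 - inner ℝ x y)‖ ≤ 2 * ‖w‖ * ‖x - y‖⁻¹ := by
    rw [norm_div, one_sub_inner hx hy, h1, Real.norm_eq_abs, Real.norm_of_nonneg (by positivity),
      div_le_iff₀ (by positivity)]
    refine (abs_det3_le _ _ _).trans (le_of_eq ?_)
    rw [hy]
    field_simp
  rw [← ofReal_norm, ← ofReal_norm, ← ofReal_norm, ← ENNReal.ofReal_inv_of_pos hpos]
  refine (ENNReal.ofReal_le_ofReal h2).trans (le_of_eq ?_)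
  rw [ENNReal.ofReal_mul (by positivity), ENNReal.ofReal_mul (by positivity)]
  simp

theorem continuous_det3 {X : Type*} [TopologicalSpace X] {f g h : X → Space3} (hf : Continuous f)
    (hg : Continuous g) (hh : Continuous h) : Continuous fun x => det3 (f x) (g x) (h x) := by
  simp only [det3_expand]
  fun_prop

/-- The integrand of the winding number, in the stereographic chart. -/
def chartAngleForm (p x : Space3) (y : ℝ → Space3) (t : ℝ) : ℝ :=
  det3 (-p) (stereo 1 p (y t) - stereo 1 p x) (deriv (fun s => stereo 1 p (y s)) t)
    / ‖stereo 1 p (y t) - stereo 1 p x‖ ^ 2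

open MeasureTheory Metric Set

/-- The surface measure of the unit sphere. -/
abbrev sphereMeasure : Measure (sphere (0 : Space3) 1) := (volume : Measure Space3).toSphere

theorem integrable_vortex {y w : ℝ → Space3} (hy : Continuous y) (hw : Continuous w)
    (hn : ∀ t, ‖y t‖ = 1) :
    Integrable (fun q : ℝ × sphere (0 : Space3) 1 =>
        det3 q.2 (y q.1) (w q.1) / (1 - inner ℝ (q.2 : Space3) (y q.1)))
      ((volume.restrict (Ioc (0 : ℝ) 1)).prod sphereMeasure) := by
  have hm : Measurable (fun q : ℝ × sphere (0 : Space3) 1 =>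
        det3 q.2 (y q.1) (w q.1) / (1 - inner ℝ (q.2 : Space3) (y q.1))) := by
    refine Measurable.div (continuous_det3 ?_ ?_ ?_).measurable (Continuous.measurable ?_) <;>
    fun_prop
  refine ⟨hm.aestronglyMeasurable, ?_⟩
  obtain ⟨B, hB⟩ := isCompact_Icc.exists_bound_of_continuousOn (s := Icc (0 : ℝ) 1)
    hw.continuousOn
  rw [HasFiniteIntegral, lintegral_prod _ hm.enorm.aemeasurable]
  set C := ∫⁻ x : sphere (0 : Space3) 1, ‖(x : Space3) - EuclideanSpace.single 2 1‖ₑ⁻¹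
    ∂sphereMeasure with hC
  have hb : ∀ t ∈ Ioc (0 : ℝ) 1, ∫⁻ x : sphere (0 : Space3) 1,
      ‖det3 x (y t) (w t) / (1 - inner ℝ (x : Space3) (y t))‖ₑ ∂sphereMeasure
      ≤ 2 * ENNReal.ofReal B * C := by
    intro t ht
    calc _ ≤ ∫⁻ x : sphere (0 : Space3) 1, 2 * ENNReal.ofReal B * ‖(x : Space3) - y t‖ₑ⁻¹
          ∂sphereMeasure := by
          refine lintegral_mono fun x => (enorm_vortex_le (w t) (by simp) (hn t)).trans ?_
          gcongr
          rw [← ofReal_norm]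
          exact ENNReal.ofReal_le_ofReal (hB t (Ioc_subset_Icc_self ht))
      _ = _ := by
          rw [lintegral_const_mul' _ _ (by finiteness), lintegral_inv_norm_sub_eq (hn t)]
  calc _ ≤ ∫⁻ _ in Ioc (0 : ℝ) 1, 2 * ENNReal.ofReal B * C :=
        setLIntegral_mono' measurableSet_Ioc hb
    _ < ⊤ := by
        have := lintegral_inv_norm_sub_pole_lt_top
        rw [← hC] at this
        simp
        finiteness

theorem integrable_background {p : Space3} {y w : ℝ → Space3} (hy : Continuous y)
    (hw : Continuous w) (hp : ∀ t ∈ Icc (0 : ℝ) 1, 1 - inner ℝ p (y t) ≠ 0) :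
    Integrable (fun t => det3 p (y t) (w t) / (1 - inner ℝ p (y t)))
      (volume.restrict (Ioc (0 : ℝ) 1)) := by
  have : ContinuousOn (fun t => det3 p (y t) (w t) / (1 - inner ℝ p (y t))) (Icc 0 1) :=
    (continuous_det3 continuous_const hy hw).continuousOn.div (by fun_prop) hp
  exact (this.integrableOn_Icc).mono_set Ioc_subset_Icc_self

/-- Fubini: for fixed `t` the vortex at `x` averages to zero over `x`, while the vortex at `p` does
not depend on `x`. The chart formula fails at most for `x = p` or `x = y t`, a null set. -/
theorem integrable_integral_chartAngleForm {p : Space3} {y w : ℝ → Space3} (hp : ‖p‖ = 1)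
    (hn : ∀ t, ‖y t‖ = 1) (hd : ∀ t, HasDerivAt y (w t) t) (hw : Continuous w)
    (hyw : ∀ t, inner ℝ (y t) (w t) = 0) (hpy : ∀ t ∈ Icc (0 : ℝ) 1, inner ℝ p (y t) ≠ 1) :
    Integrable (fun x : sphere (0 : Space3) 1 => ∫ t in (0 : ℝ)..1, chartAngleForm p x y t)
      sphereMeasure ∧
    ∫ x : sphere (0 : Space3) 1, (∫ t in (0 : ℝ)..1, chartAngleForm p x y t) ∂sphereMeasure
      = -(sphereMeasure.real univ / 2) *
        ∫ t in (0 : ℝ)..1, det3 p (y t) (w t) / (1 - inner ℝ p (y t)) := by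
  have hy : Continuous y := continuous_iff_continuousAt.2 fun t => (hd t).continuousAt
  set μ := volume.restrict (Ioc (0 : ℝ) 1)
  have hp' : ∀ t ∈ Icc (0 : ℝ) 1, 1 - inner ℝ p (y t) ≠ 0 :=
    fun t ht => sub_ne_zero.2 (hpy t ht).symm
  have h1 := integrable_vortex hy hw hn
  have h2 := integrable_background hy hw hp'
  have h3 : Integrable (fun q : ℝ × sphere (0 : Space3) 1 =>
      vortexForm p q.2 (y q.1) (w q.1)) (μ.prod sphereMeasure) :=
    (h1.sub (h2.comp_fst sphereMeasure)).div_const 2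
  have hne : ∀ v : Space3, ∀ᵐ x : sphere (0 : Space3) 1 ∂sphereMeasure, (x : Space3) ≠ v := by
    intro v
    by_cases hv : ‖v‖ = 1
    · filter_upwards [measure_eq_zero_iff_ae_notMem.1
        (toSphere_singleton ⟨v, by simpa using hv⟩)] with x hx hxv
      exact hx (Subtype.ext hxv)
    · exact Filter.Eventually.of_forall fun x hx => hv (by rw [← hx]; simp)
  have hae1 : ∀ᵐ q : ℝ × sphere (0 : Space3) 1 ∂μ.prod sphereMeasure,
      ((q.2 : Space3) ≠ p ∧ (q.2 : Space3) ≠ y q.1) := by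
    have hS : MeasurableSet {q : ℝ × sphere (0 : Space3) 1 |
        (q.2 : Space3) ≠ p ∧ (q.2 : Space3) ≠ y q.1} := by
      refine IsOpen.measurableSet ((isOpen_ne_fun ?_ ?_).inter (isOpen_ne_fun ?_ ?_)) <;> fun_prop
    refine (Measure.ae_prod_mem_iff_ae_ae_mem hS).2 (Filter.Eventually.of_forall fun t => ?_)
    filter_upwards [hne p, hne (y t)] with x hx1 hx2 using ⟨hx1, hx2⟩
  have hae2 : ∀ᵐ q : ℝ × sphere (0 : Space3) 1 ∂μ.prod sphereMeasure, q.1 ∈ Ioc (0 : ℝ) 1 :=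
    Measure.quasiMeasurePreserving_fst.ae (ae_restrict_mem measurableSet_Ioc)
  have hae : ∀ᵐ q : ℝ × sphere (0 : Space3) 1 ∂μ.prod sphereMeasure,
      vortexForm p q.2 (y q.1) (w q.1) = chartAngleForm p q.2 y q.1 := by
    filter_upwards [hae1, hae2] with q hq1 hq2
    have hq : ‖(q.2 : Space3)‖ = 1 := by simp
    refine (angleForm_eq_vortexForm hp hq (hn _) (hd _) (hyw _) ?_
      (hpy _ (Ioc_subset_Icc_self hq2)) ?_).symm
    · rw [Ne, inner_eq_one_iff_of_norm_eq_one hp hq]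
      exact hq1.1.symm
    · rw [Ne, inner_eq_one_iff_of_norm_eq_one hq (hn _)]
      exact hq1.2
  have h4 : Integrable (fun q : ℝ × sphere (0 : Space3) 1 => chartAngleForm p q.2 y q.1)
      (μ.prod sphereMeasure) := h3.congr hae
  simp only [intervalIntegral.integral_of_le zero_le_one]
  refine ⟨h4.integral_prod_right, ?_⟩
  have h5 : ∫ x : sphere (0 : Space3) 1, (∫ t, chartAngleForm p x y t ∂μ) ∂sphereMeasure
      = ∫ t, (∫ x : sphere (0 : Space3) 1, vortexForm p x (y t) (w t) ∂sphereMeasure) ∂μ := by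
    rw [← integral_prod_symm _ h4, ← integral_congr_ae hae, integral_prod _ h3]
  rw [h5, ← integral_const_mul]
  refine integral_congr_ae ?_
  filter_upwards [h1.prod_right_ae] with t ht
  simp only [vortexForm]
  rw [integral_div, integral_sub ht (integrable_const _), integral_det3_div_eq_zero,
    integral_const, smul_eq_mul]
  ring

end

noncomputable section

/-! ### Potentials of the area form -/

theorem excess_factors_pos {a b c : Space3} (ha : ‖a‖ = 1) (hb : ‖b‖ = 1) (hc : ‖c‖ = 1)
    (h : 0 < excessRe a b c) :
    0 < 1 + (inner ℝ a b : ℝ) ∧ 0 < 1 + (inner ℝ a c : ℝ) ∧ 0 < 1 + (inner ℝ b c : ℝ) := by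
  have key : ∀ u v : Space3, ‖u‖ = 1 → ‖v‖ = 1 → 0 ≤ 1 + (inner ℝ u v : ℝ) := fun u v hu hv => by
    have := abs_le.1 (abs_real_inner_le_norm u v)
    rw [hu, hv] at this
    linarith [this.1]
  have h1 := excess_norm_sq ha hb hc
  have h2 : 0 < 2 * (1 + inner ℝ a b) * (1 + inner ℝ a c) * (1 + (inner ℝ b c : ℝ)) := by
    rw [← h1]; positivity
  refine ⟨lt_of_le_of_ne (key a b ha hb) fun h0 => ?_, lt_of_le_of_ne (key a c ha hc) fun h0 => ?_,
    lt_of_le_of_ne (key b c hb hc) fun h0 => ?_⟩ <;>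
  · rw [← h0] at h2; simp at h2

/-- The oriented area of a spherical triangle on the unit sphere. -/
def triangleArea (a b c : Space3) : ℝ := 2 * Real.arctan (det3 a b c / excessRe a b c)

theorem triangleArea_aux {d e d' e' : ℝ} (he : 0 < e) :
    2 * (1 / (1 + (d / e) ^ 2) * ((d' * e - d * e') / e ^ 2))
      = 2 * (d' * e - d * e') / (e ^ 2 + d ^ 2) := by
  have h1 : e ^ 2 + d ^ 2 ≠ 0 := by positivity
  have h2 : 1 + (d / e) ^ 2 ≠ 0 := by positivity
  field_simp

/-- The area of the triangle `c a y`, as a function of `y`, is a potential for the difference of the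
area forms centred at `c` and at `a`. Positivity of `excessRe` keeps the arctangent on one smooth
branch. -/
theorem hasDerivAt_triangleArea {c a : Space3} {y : ℝ → Space3} {w : Space3} {t : ℝ}
    (hc : ‖c‖ = 1) (ha : ‖a‖ = 1) (hy : ‖y t‖ = 1) (hd : HasDerivAt y w t)
    (hw : inner ℝ (y t) w = 0) (hpos : 0 < excessRe c a (y t)) :
    HasDerivAt (fun s => triangleArea c a (y s))
      (det3 c (y t) w / (1 + inner ℝ c (y t)) - det3 a (y t) w / (1 + inner ℝ a (y t))) t := by
  obtain ⟨h1, h2, h3⟩ := excess_factors_pos hc ha hy hpos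
  have hD : HasDerivAt (fun s => det3 c a (y s)) (det3 c a w) t := by
    have : ∀ v, det3 c a v = inner ℝ (cross3 c a) v := fun v => by
      rw [real_inner_comm, inner_cross3, det3_cycle v]
    simp only [this]
    simpa using (hasDerivAt_const t (cross3 c a)).inner ℝ hd
  have hE : HasDerivAt (fun s => excessRe c a (y s)) (inner ℝ c w + inner ℝ a w) t := by
    simp only [excessRe]
    have e1 : HasDerivAt (fun s => (inner ℝ c (y s) : ℝ)) (inner ℝ c w) t := by
      simpa using (hasDerivAt_const t c).inner ℝ hd
    have e2 : HasDerivAt (fun s => (inner ℝ a (y s) : ℝ)) (inner ℝ a w) t := by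
      simpa using (hasDerivAt_const t a).inner ℝ hd
    exact (e1.const_add _).add e2
  have h := ((hD.fun_div hE hpos.ne').arctan).const_mul 2
  refine h.congr_deriv ?_
  rw [triangleArea_aux hpos, excess_deriv_identity hc ha hy hw, excess_norm_sq hc ha hy]
  field_simp

/-- The line integral of the area form with centre `c` along a curve. -/
def areaIntegral (c : Space3) (y : ℝ → Space3) : ℝ :=
  ∫ t in (0 : ℝ)..1, det3 c (y t) (deriv y t) / (1 + inner ℝ c (y t))

namespace IsArc

open Set

variable {a b : Space3}

theorem intervalIntegrable_areaForm (h : IsArc a b) {c : Space3}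
    (hc : ∀ t ∈ Icc (0 : ℝ) 1, 0 < 1 + (inner ℝ c (geodesicArc 1 a b t) : ℝ)) :
    IntervalIntegrable (fun t => det3 c (geodesicArc 1 a b t) (deriv (geodesicArc 1 a b) t)
      / (1 + inner ℝ c (geodesicArc 1 a b t))) MeasureTheory.volume 0 1 := by
  apply ContinuousOn.intervalIntegrable
  rw [uIcc_of_le zero_le_one]
  have hy := h.contDiff_arc.continuous
  exact (continuous_det3 continuous_const hy h.continuous_deriv_arc).continuousOn.div
    (by fun_prop) fun t ht => (hc t ht).ne'

theorem areaIntegral_sub (h : IsArc a b) {c e : Space3} (hc : ‖c‖ = 1) (he : ‖e‖ = 1)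
    (hpos : ∀ t ∈ Icc (0 : ℝ) 1, 0 < excessRe c e (geodesicArc 1 a b t)) :
    areaIntegral c (geodesicArc 1 a b) - areaIntegral e (geodesicArc 1 a b)
      = triangleArea c e b - triangleArea c e a := by
  have hf := fun t ht => excess_factors_pos hc he (h.norm_arc t) (hpos t ht)
  have h1 := h.intervalIntegrable_areaForm fun t ht => (hf t ht).2.1
  have h2 := h.intervalIntegrable_areaForm fun t ht => (hf t ht).2.2
  rw [areaIntegral, areaIntegral, ← intervalIntegral.integral_sub h1 h2]
  have := intervalIntegral.integral_eq_sub_of_hasDerivAt (fun t ht => hasDerivAt_triangleArea hc he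
    (h.norm_arc t) (h.hasDerivAt_arc t) (h.inner_deriv_arc t)
    (hpos t (by rwa [uIcc_of_le zero_le_one] at ht))) (h1.sub h2)
  rw [this, h.arc_one, h.arc_zero]

/-- Move the centre from `c` to the starting point `a`, where the form vanishes along the arc. -/
theorem areaIntegral_eq (h : IsArc a b) {c : Space3} (hc : ‖c‖ = 1)
    (hpos : ∀ t ∈ Icc (0 : ℝ) 1, 0 < excessRe c a (geodesicArc 1 a b t)) :
    areaIntegral c (geodesicArc 1 a b) = triangleArea c a b := by
  have h1 := h.areaIntegral_sub hc h.norm_left hpos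
  have h2 : areaIntegral a (geodesicArc 1 a b) = 0 := by
    simp [areaIntegral, h.det3_deriv_arc]
  have h3 : triangleArea c a a = 0 := by simp [triangleArea]
  linarith

end IsArc

namespace SphericalPolygon

open MeasureTheory Metric Set

variable {n : ℕ} [NeZero n] {R : ℝ}

/-- The vertices, rescaled to the unit sphere. -/
def unitVertex (Q : SphericalPolygon n R) (i : Fin n) : Space3 := R⁻¹ • Q.vertex i

theorem smul_unitVertex (hR : 0 < R) (Q : SphericalPolygon n R) (i : Fin n) :
    R • Q.unitVertex i = Q.vertex i := by
  rw [unitVertex, smul_inv_smul₀ hR.ne']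

theorem norm_unitVertex (hR : 0 < R) (Q : SphericalPolygon n R) (i : Fin n) :
    ‖Q.unitVertex i‖ = 1 := by
  rw [unitVertex, norm_smul, Q.norm_vertex, norm_inv, Real.norm_of_nonneg hR.le,
    inv_mul_cancel₀ hR.ne']

theorem inner_unitVertex (hR : 0 < R) (Q : SphericalPolygon n R) (i j : Fin n) :
    inner ℝ (Q.unitVertex i) (Q.unitVertex j)
      = Real.cos (InnerProductGeometry.angle (Q.vertex i) (Q.vertex j)) := by
  rw [InnerProductGeometry.cos_angle, Q.norm_vertex, Q.norm_vertex, unitVertex, unitVertex,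
    real_inner_smul_left, real_inner_smul_right]
  field_simp

theorem isArc (hR : 0 < R) (Q : SphericalPolygon n R) (i : Fin n) :
    IsArc (Q.unitVertex i) (Q.unitVertex (i + 1)) := by
  have h1 : 0 < InnerProductGeometry.angle (Q.vertex i) (Q.vertex (i + 1)) := by
    have := Q.edge_pos i
    rw [geodesicDist] at this
    exact (pos_iff_pos_of_mul_pos this).1 hR
  have h2 : InnerProductGeometry.angle (Q.vertex i) (Q.vertex (i + 1)) < Real.pi := by
    have := Q.edge_lt i
    rw [geodesicDist, mul_comm] at this
    exact lt_of_mul_lt_mul_right this hR.le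
  refine ⟨norm_unitVertex hR Q i, norm_unitVertex hR Q _, ?_, ?_⟩
  · rw [inner_unitVertex hR, ← Real.cos_pi]
    exact Real.cos_lt_cos_of_nonneg_of_le_pi h1.le le_rfl h2
  · rw [inner_unitVertex hR, ← Real.cos_zero]
    exact Real.cos_lt_cos_of_nonneg_of_le_pi le_rfl h2.le h1

/-- The edge, rescaled to the unit sphere. -/
abbrev unitEdge (Q : SphericalPolygon n R) (i : Fin n) : ℝ → Space3 :=
  geodesicArc 1 (Q.unitVertex i) (Q.unitVertex (i + 1))

theorem edge_eq (hR : 0 < R) (Q : SphericalPolygon n R) (i : Fin n) (t : ℝ) :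
    Q.edge i t = R • Q.unitEdge i t := by
  rw [edge, unitEdge, ← geodesicArc_smul hR, smul_unitVertex hR, smul_unitVertex hR]

theorem windingNumber_eq (hR : 0 < R) (Q : SphericalPolygon n R) (p x : Space3) :
    Q.windingNumber (R • p) (R • x)
      = (1 / (2 * Real.pi)) * ∑ i, ∫ t in (0 : ℝ)..1, chartAngleForm p x (Q.unitEdge i) t := by
  rw [windingNumber]
  congr 1
  refine Finset.sum_congr rfl fun i _ => intervalIntegral.integral_congr fun t _ => ?_
  simp only [edge_eq hR, stereo_smul hR.ne', chartAngleForm, inv_smul_smul₀ hR.ne', ← smul_sub,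
    norm_smul, Real.norm_of_nonneg hR.le, mul_pow, det3_smul_mid]
  rw [deriv_fun_const_smul_field, det3_smul_right]
  field_simp

/-- The ratio of the area of the sphere of radius `R` to `4 π` (which is in fact `R ^ 2`). -/
def areaFactor (R : ℝ) : ℝ := R ^ 2 * (sphereMeasure.real univ / (4 * Real.pi))

theorem areaFactor_pos (hR : 0 < R) : 0 < areaFactor R := by
  have : NeZero sphereMeasure := ⟨Measure.toSphere_ne_zero _⟩
  have : 0 < sphereMeasure.real univ := measureReal_univ_pos
  unfold areaFactor
  positivity

theorem area_eq_sum_areaIntegral (hR : 0 < R) (Q : SphericalPolygon n R) {p : Space3}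
    (hp : ‖p‖ = 1) (havoid : ∀ i, ∀ t ∈ Icc (0 : ℝ) 1, inner ℝ p (Q.unitEdge i t) ≠ 1) :
    Q.area (R • p) = areaFactor R * ∑ i, areaIntegral (-p) (Q.unitEdge i) := by
  have h := fun i => integrable_integral_chartAngleForm hp (Q.isArc hR i).norm_arc
    (Q.isArc hR i).hasDerivAt_arc (Q.isArc hR i).continuous_deriv_arc (Q.isArc hR i).inner_deriv_arc
    (havoid i)
  rw [area]
  simp only [windingNumber_eq hR]
  rw [integral_const_mul, integral_finsetSum _ fun i _ => (h i).1]
  simp only [(h _).2, areaIntegral, det3_neg_left, inner_neg_left, neg_div, ← sub_eq_add_neg,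
    intervalIntegral.integral_neg, ← Finset.mul_sum, Finset.sum_neg_distrib]
  rw [areaFactor]
  field_simp
  ring

end SphericalPolygon

end

noncomputable section

/-! ### Rotations -/

theorem det3_map (f : Space3 →ₗ[ℝ] Space3) (a b c : Space3) :
    det3 (f a) (f b) (f c) = LinearMap.det f * det3 a b c := by
  have key : ∀ u : Fin 3 → Space3,
      (EuclideanSpace.basisFun (Fin 3) ℝ).toBasis.det u = det3 (u 0) (u 1) (u 2) := by
    intro u
    rw [Module.Basis.det_apply, Matrix.det_fin_three, det3_expand]
    simp [Module.Basis.toMatrix_apply]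
    ring
  have h := Module.Basis.det_comp (EuclideanSpace.basisFun (Fin 3) ℝ).toBasis f ![a, b, c]
  rw [key, key] at h
  exact h

theorem IsRotation.det3_map {ρ : Space3 ≃ₗᵢ[ℝ] Space3} (hρ : IsRotation ρ) (a b c : Space3) :
    det3 (ρ a) (ρ b) (ρ c) = det3 a b c := by
  have h := _root_.det3_map (ρ.toLinearEquiv : Space3 →ₗ[ℝ] Space3) a b c
  rw [IsRotation] at hρ
  rw [hρ, one_mul] at h
  exact h

theorem geodesicArc_map (ρ : Space3 ≃ₗᵢ[ℝ] Space3) (a b : Space3) (t : ℝ) :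
    geodesicArc 1 (ρ a) (ρ b) t = ρ (geodesicArc 1 a b t) := by
  have : (1 - t) • ρ a + t • ρ b = ρ ((1 - t) • a + t • b) := by simp
  rw [geodesicArc, geodesicArc, this, ρ.norm_map, map_smul]

theorem IsRotation.areaIntegral_map {ρ : Space3 ≃ₗᵢ[ℝ] Space3} (hρ : IsRotation ρ)
    {a b : Space3} (h : IsArc a b) (c : Space3) :
    areaIntegral c (geodesicArc 1 (ρ a) (ρ b)) = areaIntegral (ρ.symm c) (geodesicArc 1 a b) := by
  have h1 : geodesicArc 1 (ρ a) (ρ b) = fun t => ρ (geodesicArc 1 a b t) :=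
    funext (geodesicArc_map ρ a b)
  rw [areaIntegral, areaIntegral, h1]
  refine intervalIntegral.integral_congr fun t _ => ?_
  have h2 : deriv (fun t => ρ (geodesicArc 1 a b t)) t = ρ (deriv (geodesicArc 1 a b) t) :=
    (ρ.toContinuousLinearEquiv.hasFDerivAt.comp_hasDerivAt t (h.hasDerivAt_arc t)).deriv
  have h3 : c = ρ (ρ.symm c) := by simp
  simp only [h2]
  nth_rewrite 1 2 [h3]
  rw [hρ.det3_map, ρ.inner_map_map]

theorem sum_fin_add_one {n : ℕ} [NeZero n] {E : Type*} [AddCommMonoid E] (f : Fin n → E) :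
    ∑ i, f (i + 1) = ∑ i, f i :=
  Equiv.sum_comp (Equiv.addRight 1) f

namespace SphericalPolygon

open Set

variable {n : ℕ} [NeZero n] {R : ℝ}

theorem sum_areaIntegral_eq_of_excess_pos (hR : 0 < R) (Q : SphericalPolygon n R)
    {c e : Space3} (hc : ‖c‖ = 1) (he : ‖e‖ = 1)
    (hpos : ∀ i, ∀ t ∈ Icc (0 : ℝ) 1, 0 < excessRe c e (Q.unitEdge i t)) :
    ∑ i, areaIntegral c (Q.unitEdge i) = ∑ i, areaIntegral e (Q.unitEdge i) := by
  rw [← sub_eq_zero, ← Finset.sum_sub_distrib]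
  have h1 := fun i => (Q.isArc hR i).areaIntegral_sub hc he (hpos i)
  simp only [h1]
  rw [Finset.sum_sub_distrib, sub_eq_zero]
  exact sum_fin_add_one fun i => triangleArea c e (Q.unitVertex i)

/-! ### Polygons close to a hemisphere -/

/-- The edges of `Q` leave the hemisphere centred at `e` by at most `δ`. -/
def AlmostInHemisphere (Q : SphericalPolygon n R) (e : Space3) (δ : ℝ) : Prop :=
  ∀ i, ∀ t ∈ Icc (0 : ℝ) 1, -δ ≤ inner ℝ e (Q.unitEdge i t)

theorem neg_one_le_inner {a b : Space3} (ha : ‖a‖ = 1) (hb : ‖b‖ = 1) :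
    -1 ≤ (inner ℝ a b : ℝ) := by
  have := abs_le.1 (abs_real_inner_le_norm a b)
  rw [ha, hb] at this
  linarith [this.1]

theorem AlmostInHemisphere.vertex (hR : 0 < R) {Q : SphericalPolygon n R} {e : Space3} {δ : ℝ}
    (hQ : Q.AlmostInHemisphere e δ) (i : Fin n) : -δ ≤ inner ℝ e (Q.unitVertex i) := by
  have := hQ i 0 (by simp)
  rwa [unitEdge, (Q.isArc hR i).arc_zero] at this

theorem AlmostInHemisphere.area_eq (hR : 0 < R) {Q : SphericalPolygon n R} {e p : Space3} {δ : ℝ}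
    (hQ : Q.AlmostInHemisphere e δ) (he : ‖e‖ = 1) (hp : ‖p‖ = 1) (hδ : δ < -inner ℝ e p) :
    Q.area (R • p) = areaFactor R * ∑ i, areaIntegral e (Q.unitEdge i) := by
  have hp' : ‖-p‖ = 1 := by rwa [norm_neg]
  -- The term `⟪-p, y⟫ ≥ -1` can at worst cancel the constant `1`; what is left is at least `-⟪e, p⟫
  -- - δ`.
  have hpos : ∀ i, ∀ t ∈ Icc (0 : ℝ) 1, 0 < excessRe (-p) e (Q.unitEdge i t) := by
    intro i t ht
    have h1 := hQ i t ht
    have h2 := neg_one_le_inner hp' ((Q.isArc hR i).norm_arc t)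
    have h3 : (inner ℝ (-p) e : ℝ) = -inner ℝ e p := by rw [inner_neg_left, real_inner_comm]
    rw [excessRe, h3]
    linarith
  rw [area_eq_sum_areaIntegral hR Q hp, Q.sum_areaIntegral_eq_of_excess_pos hR hp' he hpos]
  intro i t ht h
  have h1 := (excess_factors_pos hp' he ((Q.isArc hR i).norm_arc t) (hpos i t ht)).2.1
  rw [inner_neg_left, h] at h1
  norm_num at h1

theorem AlmostInHemisphere.sum_areaIntegral_eq (hR : 0 < R) {Q : SphericalPolygon n R}
    {e : Space3} {δ : ℝ} (hQ : Q.AlmostInHemisphere e δ) (he : ‖e‖ = 1)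
    (hδ : ∀ i, 2 * δ < 1 + inner ℝ (Q.unitVertex i) (Q.unitVertex (i + 1))) :
    ∑ i, areaIntegral e (Q.unitEdge i)
      = ∑ i, triangleArea e (Q.unitVertex i) (Q.unitVertex (i + 1)) := by
  refine Finset.sum_congr rfl fun i _ => (Q.isArc hR i).areaIntegral_eq he fun t ht => ?_
  have h1 := hQ i t ht
  have h2 := hQ.vertex hR i
  have h3 := (Q.isArc hR i).inner_le_inner_arc ht
  have h4 := hδ i
  rw [excessRe]
  linarith

/-- Rotating the polygon amounts to moving the centre from `e` to `ρ.symm e`. This could fail only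
if the two centres were nearly antipodal; but both see the polygon almost in their hemisphere, which
a vertex well inside the first one excludes. -/
theorem sum_areaIntegral_rotation (hR : 0 < R) {Q Q' : SphericalPolygon n R}
    {ρ : Space3 ≃ₗᵢ[ℝ] Space3} (hρ : IsRotation ρ) (h : ∀ i, Q'.vertex i = ρ (Q.vertex i))
    {e : Space3} {δ : ℝ} (he : ‖e‖ = 1) (hδ0 : 0 ≤ δ)
    (hQ : Q.AlmostInHemisphere e δ) (hQ' : Q'.AlmostInHemisphere e δ)
    (hbig : ∃ i, δ + 2 * √δ < inner ℝ e (Q.unitVertex i)) :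
    ∑ i, areaIntegral e (Q.unitEdge i) = ∑ i, areaIntegral e (Q'.unitEdge i) := by
  have hu : ∀ i, Q'.unitVertex i = ρ (Q.unitVertex i) := fun i => by
    rw [unitVertex, unitVertex, h i, map_smul]
  have he' : ‖ρ.symm e‖ = 1 := by simpa using he
  have hadj : ∀ x, inner ℝ e (ρ x) = (inner ℝ (ρ.symm e) x : ℝ) := fun x => by
    rw [← ρ.inner_map_map (ρ.symm e) x, ρ.apply_symm_apply]
  have h1 : ∑ i, areaIntegral e (Q'.unitEdge i) = ∑ i, areaIntegral (ρ.symm e) (Q.unitEdge i) := by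
    refine Finset.sum_congr rfl fun i _ => ?_
    rw [unitEdge, hu, hu]
    exact hρ.areaIntegral_map (Q.isArc hR i) e
  rw [h1]
  refine Q.sum_areaIntegral_eq_of_excess_pos hR he he' fun i t ht => ?_
  have h2 := hQ i t ht
  have h3 := hQ' i t ht
  rw [unitEdge, hu, hu, geodesicArc_map, hadj] at h3
  rw [excessRe]
  by_contra! hneg
  obtain ⟨j, hj⟩ := hbig
  have h4 : ‖e + ρ.symm e‖ ≤ 2 * √δ := by
    apply le_of_sq_le_sq _ (by positivity)
    rw [norm_add_sq_real, he, he', mul_pow, Real.sq_sqrt hδ0]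
    linarith
  have h5 := hQ'.vertex hR j
  rw [hu, hadj] at h5
  have h6 := (le_abs_self _).trans (abs_real_inner_le_norm (e + ρ.symm e) (Q.unitVertex j))
  rw [Q.norm_unitVertex hR, mul_one, inner_add_left] at h6
  linarith

end SphericalPolygon

end

noncomputable section

/-! ### First variation of the area -/

theorem hasDerivAt_coord {y : ℝ → Space3} {w : Space3} {t : ℝ} (h : HasDerivAt y w t) (i : Fin 3) :
    HasDerivAt (fun s => y s i) (w i) t :=
  (EuclideanSpace.proj (𝕜 := ℝ) i).hasFDerivAt.comp_hasDerivAt t h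

theorem hasDerivAt_det3 {e : Space3} {a b : ℝ → Space3} {a' b' : Space3} {t : ℝ}
    (ha : HasDerivAt a a' t) (hb : HasDerivAt b b' t) :
    HasDerivAt (fun s => det3 e (a s) (b s)) (det3 e a' (b t) + det3 e (a t) b') t := by
  have ha := hasDerivAt_coord ha
  have hb := hasDerivAt_coord hb
  simp only [det3_expand]
  refine ((((((ha 1).fun_mul (hb 2)).fun_sub ((ha 2).fun_mul (hb 1))).const_mul (e 0)).fun_sub
    ((((ha 0).fun_mul (hb 2)).fun_sub ((ha 2).fun_mul (hb 0))).const_mul (e 1))).fun_add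
    ((((ha 0).fun_mul (hb 1)).fun_sub ((ha 1).fun_mul (hb 0))).const_mul (e 2))).congr_deriv ?_
  ring

/-- `excess_deriv_identity` is used once for each moving vertex. The terms containing `e` form a
difference between the two ends, which cancels around a closed polygon. -/
theorem hasDerivAt_triangleArea_two {e : Space3} {a b : ℝ → Space3} {a' b' : Space3} {t : ℝ}
    (he : ‖e‖ = 1) (ha : ‖a t‖ = 1) (hb : ‖b t‖ = 1)
    (hda : HasDerivAt a a' t) (hdb : HasDerivAt b b' t)
    (haa : inner ℝ (a t) a' = 0) (hbb : inner ℝ (b t) b' = 0) (hpos : 0 < excessRe e (a t) (b t)) :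
    HasDerivAt (fun s => triangleArea e (a s) (b s))
      (det3 e (b t) b' / (1 + inner ℝ e (b t)) - det3 e (a t) a' / (1 + inner ℝ e (a t))
        + (det3 (b t) (a t) a' - det3 (a t) (b t) b') / (1 + inner ℝ (a t) (b t))) t := by
  obtain ⟨h1, h2, h3⟩ := excess_factors_pos he ha hb hpos
  have hE : HasDerivAt (fun s => excessRe e (a s) (b s))
      (inner ℝ e a' + inner ℝ e b' + (inner ℝ (a t) b' + inner ℝ a' (b t))) t := by
    have e1 : HasDerivAt (fun s => (inner ℝ e (a s) : ℝ)) (inner ℝ e a') t := by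
      simpa using (hasDerivAt_const t e).inner ℝ hda
    have e2 : HasDerivAt (fun s => (inner ℝ e (b s) : ℝ)) (inner ℝ e b') t := by
      simpa using (hasDerivAt_const t e).inner ℝ hdb
    exact ((e1.const_add _).add e2).add (hda.inner ℝ hdb)
  have h := (((hasDerivAt_det3 (e := e) hda hdb).fun_div hE hpos.ne').arctan).const_mul 2
  refine h.congr_deriv ?_
  have i1 := excess_deriv_identity he ha hb hbb
  have i2 := excess_deriv_identity he hb ha haa
  have s1 : excessRe e (b t) (a t) = excessRe e (a t) (b t) := by
    simp only [excessRe, real_inner_comm (a t) (b t)]; ring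
  have s2 : det3 e (b t) a' = - det3 e a' (b t) := by simp only [det3_expand]; ring
  have s3 : det3 e (b t) (a t) = - det3 e (a t) (b t) := by simp only [det3_expand]; ring
  rw [s1, s2, s3, real_inner_comm (a t) (b t), real_inner_comm a' (b t)] at i2
  have i3 : (det3 e a' (b t) + det3 e (a t) b') * excessRe e (a t) (b t)
      - det3 e (a t) (b t)
        * (inner ℝ e a' + inner ℝ e b' + (inner ℝ (a t) b' + inner ℝ a' (b t)))
      = (1 + inner ℝ e (a t)) * ((1 + inner ℝ (a t) (b t)) * det3 e (b t) b'
          - (1 + inner ℝ e (b t)) * det3 (a t) (b t) b')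
        - (1 + inner ℝ e (b t)) * ((1 + inner ℝ (a t) (b t)) * det3 e (a t) a'
          - (1 + inner ℝ e (a t)) * det3 (b t) (a t) a') := by
    linear_combination i1 - i2
  rw [triangleArea_aux hpos, i3, excess_norm_sq he ha hb]
  field_simp
  ring

/-- The contribution of an edge to the first variation of the area. -/
def edgeVariation (a b a' b' : Space3) : ℝ :=
  (det3 b a a' - det3 a b b') / (1 + inner ℝ a b)

/-- Expressing `m` through `a`, `b` and their cross product, the cross-product terms cancel because
the edge length is preserved to first order. -/
theorem edgeVariation_of_plane {a b a' b' m : Space3} (h : IsArc a b) (ha : inner ℝ a a' = 0)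
    (hb : inner ℝ b b' = 0) (hab : inner ℝ a b' + inner ℝ a' b = 0)
    (hma : inner ℝ m a = 1) (hmb : inner ℝ m b = 1) :
    edgeVariation a b a' b' = det3 m a a' - det3 m b b' := by
  have h1 : (inner ℝ a a * inner ℝ b b - inner ℝ a b ^ 2) * det3 m a a'
      = (inner ℝ m b * inner ℝ a a - inner ℝ a b * inner ℝ m a) * det3 b a a'
        + det3 m a b * (inner ℝ a a * inner ℝ a' b - inner ℝ a b * inner ℝ a a') := by
    simp only [det3_expand, inner_space3]; ring
  have h2 : (inner ℝ a a * inner ℝ b b - inner ℝ a b ^ 2) * det3 m b b'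
      = (inner ℝ m a * inner ℝ b b - inner ℝ a b * inner ℝ m b) * det3 a b b'
        + det3 m a b * (inner ℝ a b * inner ℝ b b' - inner ℝ b b * inner ℝ a b') := by
    simp only [det3_expand, inner_space3]; ring
  rw [inner_self_of_norm_one h.norm_left, inner_self_of_norm_one h.norm_right, hma, hmb, ha]
    at h1
  rw [inner_self_of_norm_one h.norm_left, inner_self_of_norm_one h.norm_right, hma, hmb, hb]
    at h2
  have hk1 := h.neg_one_lt
  have hk2 := h.lt_one
  set k : ℝ := inner ℝ a b
  rw [edgeVariation, div_eq_iff (by linarith)]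
  have hk3 : 1 - k ≠ 0 := by linarith
  apply mul_left_cancel₀ hk3
  linear_combination h2 - h1 - det3 m a b * hab

theorem edgeVariation_of_rotation {a b : Space3} (h : IsArc a b) (ω : Space3) :
    edgeVariation a b (cross3 ω a) (cross3 ω b) = inner ℝ ω b - inner ℝ ω a := by
  have key : ∀ x y : Space3, det3 x y (cross3 ω y)
      = inner ℝ y y * inner ℝ ω x - inner ℝ x y * inner ℝ ω y := fun x y => by
    simp only [det3_expand, inner_space3, cross3]
    simp
    ring
  have hk1 := h.neg_one_lt
  rw [edgeVariation, key, key, inner_self_of_norm_one h.norm_left,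
    inner_self_of_norm_one h.norm_right, real_inner_comm a b, div_eq_iff (by linarith)]
  ring

/-- A family summing to zero is the family of increments of a cyclic family. -/
theorem exists_cyclic_primitive {n : ℕ} [NeZero n] {E : Type*} [AddCommGroup E] (g : Fin n → E)
    (hg : ∑ i, g i = 0) : ∃ f : Fin n → E, ∀ i, f (i + 1) = f i + g (i + 1) := by
  obtain ⟨m, rfl⟩ := Nat.exists_eq_succ_of_ne_zero (NeZero.ne n)
  refine ⟨fun i => ∑ j ∈ Finset.Iic i, g j, fun i => ?_⟩
  induction i using Fin.lastCases with
  | last =>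
    have h1 : Finset.Iic (Fin.last m) = Finset.univ := by
      ext j; simp [Fin.le_last]
    have h2 : Finset.Iic (0 : Fin (m + 1)) = {0} := by
      ext j; simp
    beta_reduce
    rw [Fin.last_add_one, h1, h2, hg]
    simp
  | cast i =>
    have h1 : Finset.Iic (i.castSucc + 1) = insert (i.castSucc + 1) (Finset.Iic i.castSucc) := by
      ext j
      simp only [Finset.mem_Iic, Finset.mem_insert, Fin.le_def, Fin.ext_iff,
        Fin.coeSucc_eq_succ, Fin.val_succ, Fin.val_castSucc]
      omega
    beta_reduce
    rw [h1, Finset.sum_insert, add_comm]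
    simp [Fin.le_def, Fin.coeSucc_eq_succ]

/-- If the area is stationary to first order under all infinitesimal deformations that keep the
edge lengths, the vertices lie in a plane off the origin. -/
theorem exists_plane_of_stationary {n : ℕ} [NeZero n] {u : Fin n → Space3}
    (hu : ∀ i, IsArc (u i) (u (i + 1)))
    (hstat : ∀ V : Fin n → Space3, (∀ i, inner ℝ (u i) (V i) = 0) →
      (∀ i, inner ℝ (u i) (V (i + 1)) + inner ℝ (V i) (u (i + 1)) = 0) →
      ∑ i, edgeVariation (u i) (u (i + 1)) (V i) (V (i + 1)) = 0) :
    ∃ m : Space3, ∀ i, inner ℝ m (u i) = (1 : ℝ) := by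
  let T : Fin 3 → (Fin n → ℝ) →ₗ[ℝ] ℝ := fun j => ∑ i, (u i j) • LinearMap.proj i
  let S : (Fin n → ℝ) →ₗ[ℝ] ℝ := ∑ i, LinearMap.proj i
  have hker : ⨅ j, (T j).ker ≤ S.ker := by
    intro l hl
    have hl' : ∑ i, l i • u i = 0 := by
      ext j
      have := (Submodule.mem_iInf _).1 hl j
      simp only [T, LinearMap.mem_ker, LinearMap.sum_apply, LinearMap.smul_apply,
        LinearMap.proj_apply, smul_eq_mul] at this
      simp only [WithLp.ofLp_sum, Finset.sum_apply, PiLp.smul_apply, smul_eq_mul, PiLp.zero_apply]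
      rw [← this]
      exact Finset.sum_congr rfl fun i _ => mul_comm _ _
    -- `ω i` is the angular velocity of the edge from `u i` to `u (i + 1)`. Consecutive ones differ
    -- by a rotation about the shared vertex, so they agree on its velocity (`hV`).
    obtain ⟨ω, hω⟩ := exists_cyclic_primitive (fun i => l i • u i) hl'
    have hV : ∀ i, cross3 (ω (i + 1)) (u (i + 1)) = cross3 (ω i) (u (i + 1)) := fun i => by
      apply ext_inner_space3
      intro v
      rw [inner_cross3, inner_cross3, hω, det3_add_mid, det3_smul_mid]
      simp
    have h := hstat (fun i => cross3 (ω i) (u i)) (fun i => by rw [inner_cross3]; simp) fun i => by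
      simp only [hV]
      rw [inner_cross3, real_inner_comm, inner_cross3]
      simp only [det3_expand]; ring
    simp only [hV, edgeVariation_of_rotation (hu _)] at h
    rw [Finset.sum_sub_distrib, ← sum_fin_add_one (fun i => inner ℝ (ω i) (u i)),
      ← Finset.sum_sub_distrib] at h
    have hn : ∀ i, ‖u i‖ = 1 := fun i => (hu i).norm_left
    simp only [hω, inner_add_left, real_inner_smul_left, inner_self_of_norm_one (hn _),
      sub_add_cancel_left, mul_one, Finset.sum_neg_distrib, neg_eq_zero] at h
    rw [sum_fin_add_one l] at h
    simpa [S] using h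
  -- A functional vanishing on the common kernel of the coordinate functionals is a combination of
  -- them; its coefficients are the coordinates of `m`.
  have hmem := mem_span_of_iInf_ker_le_ker hker
  obtain ⟨c, hc⟩ := (Submodule.mem_span_range_iff_exists_fun ℝ).1 hmem
  refine ⟨WithLp.toLp 2 c, fun i => ?_⟩
  have h := congrArg (fun f : (Fin n → ℝ) →ₗ[ℝ] ℝ => f (Pi.single i 1)) hc
  simp [T, S, Fin.sum_univ_three, Pi.single_apply] at h
  simpa [inner_space3] using h

end

noncomputable section

/-! ### Realising infinitesimal deformations -/

theorem fin_cyclic_induction {n : ℕ} [NeZero n] {p : Fin n → Prop} {i₀ : Fin n} (h0 : p i₀)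
    (hs : ∀ i, p i → p (i + 1)) (i : Fin n) : p i := by
  have h : ∀ k : ℕ, p (i₀ + Fin.ofNat n k) := by
    intro k
    induction k with
    | zero => simpa using h0
    | succ k ih =>
      have := hs _ ih
      rw [add_assoc] at this
      convert this using 2
      ext
      simp [Fin.val_add]
  have := h (i - i₀).val
  simpa using this

theorem IsArc.eq_zero_of_smul_add_smul {a b : Space3} (h : IsArc a b) {α β : ℝ}
    (h0 : α • a + β • b = 0) : α = 0 ∧ β = 0 := by
  have h1 : inner ℝ a (α • a + β • b) = (0 : ℝ) := by rw [h0, inner_zero_right]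
  have h2 : inner ℝ b (α • a + β • b) = (0 : ℝ) := by rw [h0, inner_zero_right]
  rw [inner_add_right, real_inner_smul_right, real_inner_smul_right,
    inner_self_of_norm_one h.norm_left] at h1
  rw [inner_add_right, real_inner_smul_right, real_inner_smul_right,
    inner_self_of_norm_one h.norm_right, real_inner_comm a b] at h2
  have hk1 := h.neg_one_lt
  have hk2 := h.lt_one
  set k : ℝ := inner ℝ a b
  have h3 : (1 - k) * (1 + k) ≠ 0 := mul_ne_zero (by linarith) (by linarith)
  have h4 : β = 0 := by
    apply mul_left_cancel₀ h3
    linear_combination h2 - k * h1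
  exact ⟨by rw [h4] at h1; linarith, h4⟩

/-- A closed chain of arcs not on a great circle carries no self-stress. -/
theorem stress_eq_zero {n : ℕ} [NeZero n] {u : Fin n → Space3} (hu : ∀ i, IsArc (u i) (u (i + 1)))
    (hspan : ¬ ∃ m : Space3, m ≠ 0 ∧ ∀ i, inner ℝ m (u i) = (0 : ℝ)) {A B : Fin n → ℝ}
    (hAB : ∀ i, A (i + 1) • u (i + 1) + B (i + 1) • u (i + 1 + 1) + B i • u i = 0) :
    (∀ i, A i = 0) ∧ ∀ i, B i = 0 := by
  -- If no `B i` vanished, the equilibrium equations would carry the plane of the first edge around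
  -- the whole chain. One zero then propagates, because consecutive vertices are independent.
  have hB : ∃ i, B i = 0 := by
    by_contra! hB
    refine hspan ⟨cross3 (u 0) (u (0 + 1)), fun h0 => ?_, ?_⟩
    · have h1 := inner_cross3_self (u 0) (u (0 + 1))
      rw [h0, inner_zero_left, inner_self_of_norm_one (hu 0).norm_left,
        inner_self_of_norm_one (hu 0).norm_right] at h1
      nlinarith [(hu 0).neg_one_lt, (hu 0).lt_one]
    · set m := cross3 (u 0) (u (0 + 1)) with hm
      refine fun i => (fin_cyclic_induction (i₀ := 0)
        (p := fun i => inner ℝ m (u i) = (0 : ℝ) ∧ inner ℝ m (u (i + 1)) = (0 : ℝ)) ?_ ?_ i).1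
      · rw [real_inner_comm, hm, inner_cross3, real_inner_comm, inner_cross3]
        simp
      · rintro i ⟨h1, h2⟩
        have h3 : inner ℝ m (A (i + 1) • u (i + 1) + B (i + 1) • u (i + 1 + 1) + B i • u i)
          = (0 : ℝ) := by rw [hAB, inner_zero_right]
        simp only [inner_add_right, real_inner_smul_right, h1, h2, mul_zero, zero_add,
          add_zero] at h3
        exact ⟨h2, (mul_eq_zero.1 h3).resolve_left (hB _)⟩
  obtain ⟨i₀, hi₀⟩ := hB
  have hB0 : ∀ i, B i = 0 := fin_cyclic_induction hi₀ fun i hi => by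
    have := hAB i
    rw [hi, zero_smul, add_zero] at this
    exact ((hu _).eq_zero_of_smul_add_smul this).2
  refine ⟨fun i => ?_, hB0⟩
  have := hAB (i - 1)
  rw [hB0 (i - 1), zero_smul, add_zero, sub_add_cancel] at this
  exact ((hu _).eq_zero_of_smul_add_smul this).1

/-- The squared lengths of the vertices and the inner products along the edges. -/
def edgeData {n : ℕ} [NeZero n] (w : Fin n → Space3) (i : Fin n) : ℝ × ℝ :=
  (inner ℝ (w i) (w i), inner ℝ (w i) (w (i + 1)))

theorem contDiff_edgeData {n : ℕ} [NeZero n] : ContDiff ℝ 1 (edgeData (n := n)) := by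
  unfold edgeData
  refine contDiff_pi.2 fun i => ContDiff.prodMk ?_ ?_
  · exact (contDiff_apply ℝ Space3 i).inner ℝ (contDiff_apply ℝ Space3 i)
  · exact (contDiff_apply ℝ Space3 i).inner ℝ (contDiff_apply ℝ Space3 (i + 1))

theorem hasDerivAt_edgeData {n : ℕ} [NeZero n] {w : ℝ → Fin n → Space3} {V : Fin n → Space3}
    {t : ℝ} (hw : HasDerivAt w V t) :
    HasDerivAt (fun s => edgeData (w s)) (fun i => (2 * inner ℝ (w t i) (V i),
      inner ℝ (w t i) (V (i + 1)) + inner ℝ (V i) (w t (i + 1)))) t := by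
  have h := hasDerivAt_pi.1 hw
  refine hasDerivAt_pi.2 fun i => ?_
  refine (((h i).inner ℝ (h i)).prodMk ((h i).inner ℝ (h (i + 1)))).congr_deriv ?_
  rw [real_inner_comm (w t i) (V i)]
  ring_nf

theorem fderiv_edgeData {n : ℕ} [NeZero n] (u V : Fin n → Space3) (i : Fin n) :
    fderiv ℝ edgeData u V i
      = (2 * inner ℝ (u i) (V i), inner ℝ (u i) (V (i + 1)) + inner ℝ (V i) (u (i + 1))) := by
  have hl : HasDerivAt (fun s : ℝ => u + s • V) V 0 := by
    simpa using ((hasDerivAt_id (0 : ℝ)).smul_const V).const_add u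
  have h1 := hasDerivAt_edgeData hl
  have h2 : HasFDerivAt edgeData (fderiv ℝ edgeData u) (u + (0 : ℝ) • V) := by
    rw [zero_smul, add_zero]
    exact (contDiff_edgeData.differentiable one_ne_zero u).hasFDerivAt
  have h3 : HasDerivAt (fun s : ℝ => edgeData (u + s • V)) (fderiv ℝ edgeData u V) 0 :=
    HasFDerivAt.comp_hasDerivAt (f := fun s : ℝ => u + s • V) (0 : ℝ) h2 hl
  rw [h3.unique h1]
  simp

/-- A functional annihilating the range is a self-stress `(A, B)`: its pullback by the derivative is
the pairing with `X`, and evaluating at `X` itself gives `∑ ‖X i‖ ^ 2 = 0`, the equilibrium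
equations. -/
theorem range_fderiv_edgeData {n : ℕ} [NeZero n] {u : Fin n → Space3}
    (hu : ∀ i, IsArc (u i) (u (i + 1)))
    (hspan : ¬ ∃ m : Space3, m ≠ 0 ∧ ∀ i, inner ℝ m (u i) = (0 : ℝ)) :
    (fderiv ℝ edgeData u).range = ⊤ := by
  by_contra hne
  obtain ⟨φ, hφ0, hφ⟩ := Submodule.exists_le_ker_of_lt_top _ (lt_top_iff_ne_top.2 hne)
  set A : Fin n → ℝ := fun i => φ (Pi.single i (1, 0))
  set B : Fin n → ℝ := fun i => φ (Pi.single i (0, 1))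
  have hrep : ∀ x : Fin n → ℝ × ℝ, φ x = ∑ i, (A i * (x i).1 + B i * (x i).2) := by
    intro x
    have hx : x = ∑ i, ((x i).1 • (Pi.single i (1, 0) : Fin n → ℝ × ℝ)
        + (x i).2 • (Pi.single i (0, 1) : Fin n → ℝ × ℝ)) := by
      conv_lhs => rw [← Finset.univ_sum_single x]
      refine Finset.sum_congr rfl fun i _ => ?_
      rw [← Pi.single_smul, ← Pi.single_smul, ← Pi.single_add]
      simp
    conv_lhs => rw [hx]
    simp only [map_sum, map_add, map_smul, smul_eq_mul]
    exact Finset.sum_congr rfl fun i _ => by ring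
  set X : Fin n → Space3 := fun i =>
    (2 * A i) • u i + B i • u (i + 1) + B (i - 1) • u (i - 1) with hX
  have hX0 : ∀ i, X i = 0 := by
    have h1 : φ (fderiv ℝ edgeData u X) = 0 := hφ ⟨X, rfl⟩
    rw [hrep] at h1
    simp only [fderiv_edgeData] at h1
    have h2 : ∑ i, B i * inner ℝ (u i) (X (i + 1))
        = ∑ i, B (i - 1) * inner ℝ (u (i - 1)) (X i) := by
      rw [← sum_fin_add_one (fun i => B (i - 1) * inner ℝ (u (i - 1)) (X i))]
      simp
    have h3 : ∑ i, (inner ℝ (X i) (X i) : ℝ) = 0 := by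
      have h4 : ∀ i, (inner ℝ (X i) (X i) : ℝ) = 2 * A i * inner ℝ (u i) (X i)
          + B i * inner ℝ (X i) (u (i + 1)) + B (i - 1) * inner ℝ (u (i - 1)) (X i) := by
        intro i
        conv_lhs => enter [3]; rw [hX]
        rw [inner_add_right, inner_add_right, real_inner_smul_right, real_inner_smul_right,
          real_inner_smul_right, real_inner_comm (u i) (X i),
          real_inner_comm (u (i - 1)) (X i)]
      simp only [h4, Finset.sum_add_distrib]
      rw [← h2, ← h1, ← Finset.sum_add_distrib, ← Finset.sum_add_distrib]
      exact Finset.sum_congr rfl fun i _ => by ring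
    have h5 := (Finset.sum_eq_zero_iff_of_nonneg fun i _ => real_inner_self_nonneg).1 h3
    exact fun i => inner_self_eq_zero.1 (h5 i (Finset.mem_univ i))
  obtain ⟨hA, hB⟩ := stress_eq_zero hu hspan (A := fun i => 2 * A i) (B := B) fun i => by
    have := hX0 (i + 1)
    simpa [hX] using this
  apply hφ0
  refine LinearMap.ext fun x => ?_
  rw [hrep]
  simp only [hB, zero_mul, add_zero, LinearMap.zero_apply]
  exact Finset.sum_eq_zero fun i _ => by
    have := hA i
    rw [show A i = 0 by linarith, zero_mul]

/-- Every infinitesimal deformation of a closed chain of arcs that keeps the edge lengths is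
tangent to an actual deformation, unless the chain lies on a great circle. -/
theorem exists_deformation {n : ℕ} [NeZero n] {u V : Fin n → Space3}
    (hu : ∀ i, IsArc (u i) (u (i + 1)))
    (hspan : ¬ ∃ m : Space3, m ≠ 0 ∧ ∀ i, inner ℝ m (u i) = (0 : ℝ))
    (hV : ∀ i, inner ℝ (u i) (V i) = (0 : ℝ))
    (hV' : ∀ i, inner ℝ (u i) (V (i + 1)) + inner ℝ (V i) (u (i + 1)) = (0 : ℝ)) :
    ∃ w : ℝ → Fin n → Space3, w 0 = u ∧ HasDerivAt w V 0 ∧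
      ∀ᶠ s in 𝓝 0, edgeData (w s) = edgeData u := by
  have hf : HasStrictFDerivAt edgeData (fderiv ℝ edgeData u) u :=
    contDiff_edgeData.contDiffAt.hasStrictFDerivAt one_ne_zero
  have hr := range_fderiv_edgeData hu hspan
  have hVk : V ∈ (fderiv ℝ edgeData u).ker := by
    rw [LinearMap.mem_ker]
    ext i : 1
    exact (fderiv_edgeData u V i).trans (by rw [hV, hV']; simp)
  -- The fibre is parametrised by the kernel, with the inclusion as derivative at zero; the family
  -- is the image of the line through `V`.
  set g := hf.implicitFunction _ _ hr (edgeData u)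
  have hline : Filter.Tendsto (fun s : ℝ => s • (⟨V, hVk⟩ : (fderiv ℝ edgeData u).ker)) (𝓝 0)
      (𝓝 0) := by
    have : Continuous (fun s : ℝ => s • (⟨V, hVk⟩ : (fderiv ℝ edgeData u).ker)) := by fun_prop
    simpa using this.tendsto 0
  refine ⟨fun s => g (s • ⟨V, hVk⟩), ?_, ?_, ?_⟩
  · simp only [zero_smul]
    exact hf.implicitFunction_apply_image hr
  · have h1 := (hf.to_implicitFunction hr).hasFDerivAt
    have hl : HasDerivAt (fun s : ℝ => s • (⟨V, hVk⟩ : (fderiv ℝ edgeData u).ker)) ⟨V, hVk⟩ 0 := by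
      simpa using (hasDerivAt_id (0 : ℝ)).smul_const (⟨V, hVk⟩ : (fderiv ℝ edgeData u).ker)
    rw [← zero_smul ℝ (⟨V, hVk⟩ : (fderiv ℝ edgeData u).ker)] at h1
    exact h1.comp_hasDerivAt (0 : ℝ) hl
  · exact ((tendsto_const_nhds (x := edgeData u)).prodMk_nhds hline).eventually
      (hf.map_implicitFunction_eq hr)

end

noncomputable section

namespace SphericalPolygon

variable {n : ℕ} [NeZero n] {R : ℝ}

/-! ### Cyclic polygons -/

/-- Cosphericity is automatic, so only coplanarity counts; a plane containing the vertices misses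
the origin because `P` is not on a great circle, and its normal can be rescaled. -/
theorem exists_plane_iff_isCyclic (hR : 0 < R) (P : SphericalPolygon n R)
    (hP : ¬ P.OnGreatCircle) :
    (∃ m : Space3, ∀ i, inner ℝ m (P.unitVertex i) = (1 : ℝ)) ↔ P.IsCyclic := by
  constructor
  · rintro ⟨m, hm⟩
    have hm0 : m ≠ 0 := by
      rintro rfl
      simpa using hm 0
    refine ⟨⟨0, R, ?_⟩, ?_⟩
    · rintro _ ⟨i, rfl⟩
      rw [dist_zero_right, P.norm_vertex]
    · rw [coplanar_iff_finrank_le_two]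
      have hsub : vectorSpan ℝ (Set.range P.vertex) ≤ (ℝ ∙ m)ᗮ := by
        rw [vectorSpan_def, Submodule.span_le]
        rintro _ ⟨_, ⟨i, rfl⟩, _, ⟨j, rfl⟩, rfl⟩
        rw [SetLike.mem_coe, Submodule.mem_orthogonal_singleton_iff_inner_right]
        simp only [vsub_eq_sub]
        rw [← P.smul_unitVertex hR i, ← P.smul_unitVertex hR j, ← smul_sub, real_inner_smul_right,
          inner_sub_right, hm, hm, sub_self, mul_zero]
      have : Fact (Module.finrank ℝ Space3 = 2 + 1) := ⟨by simp⟩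
      exact (Submodule.finrank_mono hsub).trans
        (Submodule.finrank_orthogonal_span_singleton hm0).le
  · rintro ⟨-, hcop⟩
    rw [coplanar_iff_finrank_le_two] at hcop
    set W := vectorSpan ℝ (Set.range P.vertex)
    have hW : Wᗮ ≠ ⊥ := by
      intro h
      have h1 := Submodule.finrank_add_finrank_orthogonal W
      rw [h, finrank_bot, finrank_euclideanSpace_fin] at h1
      omega
    obtain ⟨ν, hν, hν0⟩ := Submodule.exists_mem_ne_zero_of_ne_bot hW
    have hc : ∀ i, inner ℝ ν (P.vertex i) = (inner ℝ ν (P.vertex 0) : ℝ) := fun i => by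
      have h1 : P.vertex i - P.vertex 0 ∈ W :=
        vsub_mem_vectorSpan ℝ (Set.mem_range_self i) (Set.mem_range_self 0)
      have h2 := (Submodule.mem_orthogonal' W ν).1 hν _ h1
      rwa [inner_sub_right, sub_eq_zero] at h2
    have hk : (inner ℝ ν (P.vertex 0) : ℝ) ≠ 0 := fun h0 =>
      hP ⟨ν, hν0, fun i => by rw [hc, h0]⟩
    refine ⟨(R / inner ℝ ν (P.vertex 0)) • ν, fun i => ?_⟩
    rw [unitVertex, real_inner_smul_left, real_inner_smul_right, hc i]
    field_simp

/-! ### First variation along a family of polygons -/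

theorem hasDerivAt_sum_triangleArea {e : Space3} (he : ‖e‖ = 1) {u : ℝ → Fin n → Space3}
    {U : Fin n → Space3} (hu : ∀ i, ‖u 0 i‖ = 1) (hd : ∀ i, HasDerivAt (fun t => u t i) (U i) 0)
    (hU : ∀ i, inner ℝ (u 0 i) (U i) = (0 : ℝ))
    (hpos : ∀ i, 0 < excessRe e (u 0 i) (u 0 (i + 1))) :
    HasDerivAt (fun t => ∑ i, triangleArea e (u t i) (u t (i + 1)))
      (∑ i, edgeVariation (u 0 i) (u 0 (i + 1)) (U i) (U (i + 1))) 0 := by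
  have h := fun i => hasDerivAt_triangleArea_two (a := fun t => u t i) (b := fun t => u t (i + 1))
    he (hu i) (hu (i + 1)) (hd i) (hd (i + 1)) (hU i) (hU (i + 1)) (hpos i)
  refine (HasDerivAt.fun_sum fun i _ => h i).congr_deriv ?_
  rw [Finset.sum_add_distrib, Finset.sum_sub_distrib,
    sum_fin_add_one (fun i => det3 e (u 0 i) (U i) / (1 + inner ℝ e (u 0 i))), sub_self, zero_add]
  rfl

/-- The infinitesimal deformations that keep the edge lengths. -/
def IsFlex (u U : Fin n → Space3) : Prop :=
  (∀ i, inner ℝ (u i) (U i) = (0 : ℝ)) ∧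
    ∀ i, inner ℝ (u i) (U (i + 1)) + inner ℝ (U i) (u (i + 1)) = (0 : ℝ)

namespace NearbyPolygon

variable {P : SphericalPolygon n R} {ε : ℝ}

theorem inner_unitVertex (hR : 0 < R) (Q : P.NearbyPolygon ε) (i : Fin n) :
    (inner ℝ (Q.1.unitVertex i) (Q.1.unitVertex (i + 1)) : ℝ)
      = inner ℝ (P.unitVertex i) (P.unitVertex (i + 1)) := by
  have h := Q.2.1 i
  rw [edgeLength, edgeLength, geodesicDist, geodesicDist] at h
  rw [SphericalPolygon.inner_unitVertex hR, SphericalPolygon.inner_unitVertex hR,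
    mul_left_cancel₀ hR.ne' h]

theorem abs_inner_sub_le (hR : 0 < R) (Q : P.NearbyPolygon ε) {e : Space3} (he : ‖e‖ = 1)
    (i : Fin n) : |inner ℝ e (Q.1.unitVertex i) - inner ℝ e (P.unitVertex i)| ≤ ε / R := by
  have h1 : ‖Q.1.unitVertex i - P.unitVertex i‖ ≤ ε / R := by
    rw [unitVertex, unitVertex, ← smul_sub, norm_smul, norm_inv, Real.norm_of_nonneg hR.le,
      ← dist_eq_norm, inv_mul_eq_div]
    exact div_le_div_of_nonneg_right (Q.2.2 i).le hR.le
  rw [← inner_sub_right]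
  refine (abs_real_inner_le_norm _ _).trans ?_
  rwa [he, one_mul]

theorem almostInHemisphere (hR : 0 < R) (hε : 0 < ε) (Q : P.NearbyPolygon ε) {e : Space3}
    (he : ‖e‖ = 1) (hP : ∀ i, 0 ≤ inner ℝ e (P.unitVertex i)) {M : ℝ} (hM : 0 ≤ M)
    (hMP : ∀ i, 2 ≤ M ^ 2 * (1 + inner ℝ (P.unitVertex i) (P.unitVertex (i + 1)))) :
    Q.1.AlmostInHemisphere e (M * (ε / R)) := by
  intro i t ht
  have hv : ∀ j, -(ε / R) ≤ inner ℝ e (Q.1.unitVertex j) := fun j => by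
    have := abs_le.1 (Q.abs_inner_sub_le hR he j)
    linarith [this.1, hP j]
  refine (Q.1.isArc hR i).neg_le_inner_arc ht (by positivity) hM ?_ (hv i) (hv (i + 1))
  rw [Q.inner_unitVertex hR]
  exact hMP i

/-- The first variation along a differentiable family of nearby polygons is a flex. -/
theorem exists_flex (hR : 0 < R) {γ : ℝ → P.NearbyPolygon ε} (h0 : (γ 0).1 = P)
    (hd : DifferentiableAt ℝ (fun t => (γ t).1.vertex) 0) :
    ∃ U : Fin n → Space3, (∀ i, HasDerivAt (fun t => (γ t).1.unitVertex i) (U i) 0) ∧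
      IsFlex P.unitVertex U := by
  have h1 := hasDerivAt_pi.1 hd.hasDerivAt
  have hU : ∀ i, HasDerivAt (fun t => (γ t).1.unitVertex i)
      (R⁻¹ • deriv (fun t => (γ t).1.vertex) 0 i) 0 := fun i => (h1 i).const_smul R⁻¹
  refine ⟨_, hU, fun i => ?_, fun i => ?_⟩
  · have h2 := (hU i).inner ℝ (hU i)
    simp only [inner_self_of_norm_one (SphericalPolygon.norm_unitVertex hR _ _), h0] at h2
    have h3 := h2.unique (hasDerivAt_const 0 1)
    rw [real_inner_comm (P.unitVertex i)] at h3
    linarith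
  · have h2 := (hU i).inner ℝ (hU (i + 1))
    simp only [inner_unitVertex hR, h0] at h2
    exact h2.unique (hasDerivAt_const 0 _)

/-- Every flex is realised by a differentiable family of nearby polygons. -/
theorem exists_family_of_flex (hR : 0 < R) (hε : 0 < ε) (hP : ¬ P.OnGreatCircle)
    {U : Fin n → Space3} (hU : IsFlex P.unitVertex U) :
    ∃ γ : ℝ → P.NearbyPolygon ε, (γ 0).1 = P ∧
      DifferentiableAt ℝ (fun t => (γ t).1.vertex) 0 ∧
      ∀ i, HasDerivAt (fun t => (γ t).1.unitVertex i) (U i) 0 := by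
  have hspan : ¬ ∃ m : Space3, m ≠ 0 ∧ ∀ i, inner ℝ m (P.unitVertex i) = (0 : ℝ) := by
    rintro ⟨m, hm, h⟩
    refine hP ⟨m, hm, fun i => ?_⟩
    rw [← P.smul_unitVertex hR, real_inner_smul_right, h, mul_zero]
  obtain ⟨w, hw0, hwd, hwe⟩ := exists_deformation (P.isArc hR) hspan hU.1 hU.2
  have hex : ∀ t, edgeData (w t) = edgeData P.unitVertex →
      (∀ i, dist (R • w t i) (P.vertex i) < ε) → ∃ Q : P.NearbyPolygon ε,
        ∀ i, Q.1.vertex i = R • w t i := by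
    intro t hdat hdist
    have h1 : ∀ i, ‖w t i‖ = 1 := fun i => by
      have := congrArg Prod.fst (congrFun hdat i)
      simp only [edgeData, inner_self_of_norm_one (P.norm_unitVertex hR i),
        real_inner_self_eq_norm_sq] at this
      exact (pow_eq_one_iff_of_nonneg (norm_nonneg _) two_ne_zero).1 this
    have h2 : ∀ i, geodesicDist R (R • w t i) (R • w t (i + 1)) = P.edgeLength i := fun i => by
      have := congrArg Prod.snd (congrFun hdat i)
      simp only [edgeData] at this
      rw [edgeLength, ← P.smul_unitVertex hR, ← P.smul_unitVertex hR, geodesicDist, geodesicDist,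
        InnerProductGeometry.angle_smul_smul hR.ne', InnerProductGeometry.angle_smul_smul hR.ne',
        InnerProductGeometry.angle, InnerProductGeometry.angle, this, h1, h1,
        P.norm_unitVertex hR, P.norm_unitVertex hR]
    exact ⟨⟨⟨fun i => R • w t i, fun i => by
      rw [norm_smul, h1, Real.norm_of_nonneg hR.le, mul_one],
      fun i => by rw [h2]; exact P.edge_pos i, fun i => by rw [h2]; exact P.edge_lt i⟩,
      h2, hdist⟩, fun i => rfl⟩
  let P₀ : P.NearbyPolygon ε := ⟨P, fun _ => rfl, fun i => by rwa [dist_self]⟩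
  classical
  -- `P₀` is the default where `w t` gives no nearby polygon. The clause `t ≠ 0` makes `γ 0` the
  -- polygon `P` itself without unfolding a choice.
  let γ : ℝ → P.NearbyPolygon ε := fun t =>
    if h : t ≠ 0 ∧ edgeData (w t) = edgeData P.unitVertex ∧
      ∀ i, dist (R • w t i) (P.vertex i) < ε
    then (hex t h.2.1 h.2.2).choose else P₀
  have hγ0 : (γ 0).1 = P := by simp [γ, P₀]
  have hdist : ∀ᶠ t in 𝓝 (0 : ℝ), ∀ i, dist (R • w t i) (P.vertex i) < ε := by
    refine Filter.eventually_all.2 fun i => ?_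
    have hc : ContinuousAt (fun t => dist (R • w t i) (P.vertex i)) 0 :=
      (((hasDerivAt_pi.1 hwd i).continuousAt).const_smul R).dist continuousAt_const
    refine hc.eventually_lt continuousAt_const ?_
    rw [hw0, P.smul_unitVertex hR, dist_self]
    exact hε
  have hγ : ∀ᶠ t in 𝓝 (0 : ℝ), (γ t).1.vertex = fun i => R • w t i := by
    filter_upwards [hwe, hdist] with t h1 h2
    funext i
    by_cases ht : t = 0
    · rw [ht, hγ0, hw0, P.smul_unitVertex hR]
    · have hcond : t ≠ 0 ∧ edgeData (w t) = edgeData P.unitVertex ∧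
        ∀ i, dist (R • w t i) (P.vertex i) < ε := ⟨ht, h1, h2⟩
      simp only [γ, dif_pos hcond]
      exact (hex t h1 h2).choose_spec i
  refine ⟨γ, hγ0, ?_, fun i => ?_⟩
  · have h1 : DifferentiableAt ℝ (fun t => R • w t) 0 := hwd.differentiableAt.const_smul R
    exact h1.congr_of_eventuallyEq hγ
  · refine (hasDerivAt_pi.1 hwd i).congr_of_eventuallyEq ?_
    filter_upwards [hγ] with t ht
    rw [unitVertex, ht, inv_smul_smul₀ hR.ne']

end NearbyPolygon

theorem isCriticalPoint_iff_isCyclic (hR : 0 < R) {P : SphericalPolygon n R}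
    (hP : ¬ P.OnGreatCircle) {ε : ℝ} (hε : 0 < ε) {e : Space3} (he : ‖e‖ = 1)
    (hPe : ∀ i, 0 ≤ inner ℝ e (P.unitVertex i)) {K : ℝ} (hK : K ≠ 0)
    {A : P.LocalConfig ε → ℝ}
    (hA : ∀ Q : P.NearbyPolygon ε, A Q.toLocalConfig
      = K * ∑ i, triangleArea e (Q.1.unitVertex i) (Q.1.unitVertex (i + 1))) :
    P.IsCriticalPoint ε A ↔ P.IsCyclic := by
  have hpos : ∀ i, 0 < excessRe e (P.unitVertex i) (P.unitVertex (i + 1)) := fun i => by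
    have := (P.isArc hR i).neg_one_lt
    rw [excessRe]
    linarith [hPe i, hPe (i + 1)]
  have hvar : ∀ (γ : ℝ → P.NearbyPolygon ε) (U : Fin n → Space3), (γ 0).1 = P →
      (∀ i, HasDerivAt (fun t => (γ t).1.unitVertex i) (U i) 0) → IsFlex P.unitVertex U →
      HasDerivAt (fun t => A (γ t).toLocalConfig) (K * ∑ i, edgeVariation (P.unitVertex i)
        (P.unitVertex (i + 1)) (U i) (U (i + 1))) 0 := by
    intro γ U h0 hd hU
    simp only [hA]
    have h1 := hasDerivAt_sum_triangleArea he (u := fun t => (γ t).1.unitVertex) (U := U)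
      (by simp only [h0]; exact P.norm_unitVertex hR) hd (by simp only [h0]; exact hU.1)
      (by simp only [h0]; exact hpos)
    simp only [h0] at h1
    exact h1.const_mul K
  rw [← exists_plane_iff_isCyclic hR P hP]
  constructor
  · intro hcrit
    refine exists_plane_of_stationary (P.isArc hR) fun U hU hU' => ?_
    obtain ⟨γ, h0, hd, hγ⟩ := NearbyPolygon.exists_family_of_flex hR hε hP ⟨hU, hU'⟩
    have h1 := (hvar γ U h0 hγ ⟨hU, hU'⟩).unique (hcrit γ h0 hd)
    exact (mul_eq_zero.1 h1).resolve_left hK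
  · rintro ⟨m, hm⟩ γ h0 hd
    obtain ⟨U, hγ, hU⟩ := NearbyPolygon.exists_flex hR h0 hd
    refine (hvar γ U h0 hγ hU).congr_deriv ?_
    have h1 : ∀ i, edgeVariation (P.unitVertex i) (P.unitVertex (i + 1)) (U i) (U (i + 1))
        = det3 m (P.unitVertex i) (U i) - det3 m (P.unitVertex (i + 1)) (U (i + 1)) := fun i =>
      edgeVariation_of_plane (P.isArc hR i) (hU.1 i) (hU.1 (i + 1)) (hU.2 i) (hm i) (hm (i + 1))
    simp only [h1]
    rw [Finset.sum_sub_distrib, sum_fin_add_one (fun i => det3 m (P.unitVertex i) (U i)),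
      sub_self, mul_zero]

end SphericalPolygon

/-! ### Choice of `ε` and conclusion -/

theorem exists_coefficient_bound {ι : Type*} [Fintype ι] {q : ι → ℝ} (hq : ∀ i, 0 < q i) :
    ∃ M : ℝ, 0 ≤ M ∧ ∀ i, 2 ≤ M ^ 2 * q i := by
  have hq' : ∀ i, 0 ≤ 2 / q i := fun i => (div_pos two_pos (hq i)).le
  have hS : 0 ≤ ∑ i, 2 / q i := Finset.sum_nonneg fun i _ => hq' i
  refine ⟨1 + ∑ i, 2 / q i, by linarith, fun i => ?_⟩
  have h1 : 2 / q i ≤ ∑ i, 2 / q i :=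
    Finset.single_le_sum (fun i _ => hq' i) (Finset.mem_univ i)
  rw [← div_le_iff₀ (hq i)]
  nlinarith

end

theorem mainTheorem8 {n : ℕ} [NeZero n] {R : ℝ} (hR : 0 < R)
    (P : SphericalPolygon n R)
    (hP : ¬ P.OnGreatCircle)
    (c infty : Space3) (hc : ‖c‖ = R) (hinfty : ‖infty‖ = R)
    (hfit : P.trace ⊆ closedHemisphere R c)
    (hout : infty ∉ closedHemisphere R c) :
    ∀ᶠ ε in 𝓝[>] (0 : ℝ), ∃ A : P.LocalConfig ε → ℝ,
      (∀ Q : P.NearbyPolygon ε, A Q.toLocalConfig = Q.1.area infty) ∧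
      (P.IsCriticalPoint ε A ↔ P.IsCyclic) := by
  obtain ⟨e, rfl⟩ : ∃ e : Space3, c = R • e := ⟨R⁻¹ • c, by rw [smul_inv_smul₀ hR.ne']⟩
  obtain ⟨p, rfl⟩ : ∃ p : Space3, infty = R • p := ⟨R⁻¹ • infty, by rw [smul_inv_smul₀ hR.ne']⟩
  have hunit : ∀ v : Space3, ‖R • v‖ = R → ‖v‖ = 1 := fun v hv => by
    rw [norm_smul, Real.norm_of_nonneg hR.le] at hv
    exact mul_left_cancel₀ hR.ne' (hv.trans (mul_one R).symm)
  have he := hunit e hc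
  have hp := hunit p hinfty
  have hep : 0 < -(inner ℝ e p : ℝ) := by
    by_contra! h
    refine hout ⟨hinfty, ?_⟩
    rw [real_inner_smul_left, real_inner_smul_right]
    have : 0 ≤ (inner ℝ e p : ℝ) := by linarith
    positivity
  have hPe : ∀ i, 0 ≤ (inner ℝ e (P.unitVertex i) : ℝ) := fun i => by
    have h1 : P.vertex i ∈ P.trace := by
      refine Set.mem_iUnion.2 ⟨i, 0, by simp, ?_⟩
      rw [SphericalPolygon.edge_eq hR, SphericalPolygon.unitEdge,
        (P.isArc hR i).arc_zero, P.smul_unitVertex hR]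
    have h2 := (hfit h1).2
    rw [← P.smul_unitVertex hR, real_inner_smul_left, real_inner_smul_right, ← mul_assoc] at h2
    exact nonneg_of_mul_nonneg_right h2 (by positivity)
  -- Otherwise all vertices would lie on the boundary great circle of the hemisphere.
  obtain ⟨j, hj⟩ : ∃ j, 0 < (inner ℝ e (P.unitVertex j) : ℝ) := by
    by_contra! h
    refine hP ⟨e, fun h0 => by simp [h0] at he, fun i => ?_⟩
    rw [← P.smul_unitVertex hR, real_inner_smul_right, le_antisymm (h i) (hPe i), mul_zero]
  have hk : ∀ i, 0 < 1 + (inner ℝ (P.unitVertex i) (P.unitVertex (i + 1)) : ℝ) := fun i => by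
    linarith [(P.isArc hR i).neg_one_lt]
  obtain ⟨M, hM, hMP⟩ : ∃ M : ℝ, 0 ≤ M ∧
      ∀ i, 2 ≤ M ^ 2 * (1 + inner ℝ (P.unitVertex i) (P.unitVertex (i + 1))) :=
    exists_coefficient_bound hk
  have hlim : ∀ {f : ℝ → ℝ} {a : ℝ}, Continuous f → f 0 < a → ∀ᶠ ε in 𝓝[>] (0 : ℝ), f ε < a :=
    fun hf h => nhdsWithin_le_nhds (hf.continuousAt.eventually_lt continuousAt_const h)
  -- With `δ = M * (ε / R)`: `e1` lets the centre move from `-p` to `e`, `e2` turns line integrals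
  -- into triangle areas, and `e3` gives rotation invariance, its last `ε / R` being the
  -- displacement of vertex `j`.
  have e1 : ∀ᶠ ε in 𝓝[>] (0 : ℝ), M * (ε / R) < -(inner ℝ e p : ℝ) :=
    hlim (by fun_prop) (by simpa using hep)
  have e2 : ∀ᶠ ε in 𝓝[>] (0 : ℝ), ∀ i,
      2 * (M * (ε / R)) < 1 + (inner ℝ (P.unitVertex i) (P.unitVertex (i + 1)) : ℝ) :=
    Filter.eventually_all.2 fun i => hlim (by fun_prop) (by simpa using hk i)
  have e3 : ∀ᶠ ε in 𝓝[>] (0 : ℝ),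
      M * (ε / R) + 2 * √(M * (ε / R)) + ε / R < (inner ℝ e (P.unitVertex j) : ℝ) :=
    hlim (by fun_prop) (by simpa using hj)
  filter_upwards [e1, e2, e3, self_mem_nhdsWithin] with ε h1 h2 h3 (hε : 0 < ε)
  have hal : ∀ Q : P.NearbyPolygon ε, Q.1.AlmostInHemisphere e (M * (ε / R)) :=
    fun Q => Q.almostInHemisphere hR hε he hPe hM hMP
  have harea : ∀ Q : P.NearbyPolygon ε, Q.1.area (R • p)
      = SphericalPolygon.areaFactor R * ∑ i, areaIntegral e (Q.1.unitEdge i) :=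
    fun Q => (hal Q).area_eq hR he hp h1
  have hwd : ∀ Q Q' : P.NearbyPolygon ε, (P.rotationSetoid ε).r Q Q' →
      Q.1.area (R • p) = Q'.1.area (R • p) := by
    rintro Q Q' ⟨ρ, hρ, h⟩
    rw [harea, harea, SphericalPolygon.sum_areaIntegral_rotation hR hρ h he (by positivity) (hal Q)
      (hal Q') ⟨j, ?_⟩]
    have := (abs_le.1 (Q.abs_inner_sub_le hR he j)).1
    linarith
  refine ⟨Quotient.lift (fun Q => Q.1.area (R • p)) hwd, fun Q => rfl, ?_⟩
  refine SphericalPolygon.isCriticalPoint_iff_isCyclic hR hP hε he hPe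
    (SphericalPolygon.areaFactor_pos hR).ne' fun Q => ?_
  rw [← (hal Q).sum_areaIntegral_eq hR he fun i => by rw [Q.inner_unitVertex hR]; exact h2 i]
  exact harea Q
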